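/- **Setting.** Let $\alpha>1/2$ be real, let $\boldsymbol\gamma=(\gamma_1,\gamma_2,\dots)$ be weights with $0\le\gamma_j\le 1$, and let $\eta\in(0,1)$. For $d\in\mathbb N$ and $\boldsymbol k\in\mathbb Z^d$ put $r_{\alpha,\boldsymbol\gamma}(\boldsymbol k)=\prod_{j:\,k_j\neq0}|k_j|^\alpha/\gamma_j\in(0,\infty]$ (a factor with $\gamma_j=0$ is $\infty$). The weighted Korobov space $H_{\alpha,\boldsymbol\gamma}$ consists of the functions $f:[0,1]^d\to\mathbb R$, one-periodic in each variable, that equal their absolutely convergent Fourier series $\sum_{\boldsymbol k}\hat f(\boldsymbol k)e^{2\pi i\boldsymbol k\cdot\boldsymbol x}$ and satisfy $\|f\|_{\alpha,\boldsymbol\gamma}^2=\sum_{\boldsymbol k}|\hat f(\boldsymbol k)|^2r_{\alpha,\boldsymbol\gamma}(\boldsymbol k)^2<\infty$ (with $0\cdot\infty=0$). Write $I(f)=\int_{[0,1]^d}f(\boldsymbol x)\,d\boldsymbol x$. For an integer $N\ge2$, $\boldsymbol z\in\{1,\dots,N-1\}^d$ and a shift $\boldsymbol\Delta\in[0,1]^d$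 let $$Q_{N,\boldsymbol z,\boldsymbol\Delta}(f)=\frac1N\sum_{n=0}^{N-1}f\bigl(\{n\boldsymbol z/N+\boldsymbol\Delta\}\bigr),$$ with $\{\cdot\}$ the componentwise fractional part, and let $e^{\mathrm{wor}}(N,\boldsymbol z)=\sup_{\|f\|_{\alpha,\boldsymbol\gamma}\le1}|I(f)-Q_{N,\boldsymbol z,\boldsymbol 0}(f)|$. For $r,M\in\mathbb N$, $M\ge2$, the randomized rule $\tilde A^{\mathrm{ran}}_{r,M}$ is defined as follows: draw $N$ uniformly from the primes $p$ with $\lceil M/2\rceil<p\le M$; given $N$, draw $\boldsymbol z_1,\dots,\boldsymbol z_r$ independently and uniformly from $\{1,\dots,N-1\}^d$; let $\boldsymbol z^*$ be a $\boldsymbol z_j$ with minimal $e^{\mathrm{wor}}(N,\boldsymbol z_j)$ (ties broken by any fixed rule depending only on $N,\boldsymbol z_1,\dots,\boldsymbol z_r$); draw $\boldsymbol\Delta$ independently and uniformly from $[0,1]^d$; use $Q_{N,\boldsymbol z^*,\boldsymbol\Delta}$. Its worst-case root-mean-squared error is $$e^{\mathrm{rms}}(H_{\alpha,\boldsymbol\gamma};\tilde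 A^{\mathrm{ran}}_{r,M})=\sup_{\|f\|_{\alpha,\boldsymbol\gamma}\le1}\Bigl(\mathbb E\bigl[|I(f)-Q_{N,\boldsymbol z^*,\boldsymbol\Delta}(f)|^2\bigr]\Bigr)^{1/2}.$$ **Statement.** Consider integers $M\ge2$ such that $$(1-\eta)M\ \ge\ \inf_{1/2\le\lambda<\alpha}\,2\prod_{j=1}^d\bigl(1+2\gamma_j^{1/\lambda}\zeta(\alpha/\lambda)\bigr),\tag{$*$}$$ and take $r=\left\lceil-(2\alpha+1)\dfrac{\log M}{\log(1-\eta)}\right\rceil$. 1. For every $d$, every $\lambda\in[1/2,\alpha)$ and every $\delta\in(0,1/\alpha]$ there is a constant $C>0$, independent of $M$ and of the tie-breaking rule, such that for all $M\ge2$ satisfying $(*)$ $$e^{\mathrm{rms}}(H_{\alpha,\boldsymbol\gamma};\tilde A^{\mathrm{ran}}_{r,M})\le C\,M^{-\lambda-1/2+\lambda\delta/2}\log M .$$ 2. The rate is arbitrarily close to $M^{-\alpha-1/2}$: for every $d$ and every $\varepsilon>0$ there is a constant $C>0$, independent of $M$ and of the tie-breaking rule, such that $e^{\mathrm{rms}}(H_{\alpha,\boldsymbol\gamma};\tilde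 A^{\mathrm{ran}}_{r,M})\le C\,M^{-\alpha-1/2+\varepsilon}$ for all $M\ge2$ satisfying $(*)$. 3. If $\sum_{j=1}^\infty\gamma_j^{1/\alpha}<\infty$, then the constants in 1 and 2 can moreover be chosen independently of the dimension $d$. -/

import Mathlib

open scoped ENNReal

/-! Functions on the cube that are one-periodic in each variable are represented by one-periodic
functions on `Fin d → ℝ`; the weights `γ₁, γ₂, …` are `γ 0, γ 1, …`. -/

/-- The integral of `f` over the unit cube. -/
noncomputable def cubeIntegral {d : ℕ} (f : (Fin d → ℝ) → ℝ) : ℝ :=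
  ∫ x in Set.Icc (0 : Fin d → ℝ) 1, f x

/-- The Fourier mode with frequency `k`, i.e. `exp (2 π i k·x)`. -/
noncomputable def fourierMode {d : ℕ} (k : Fin d → ℤ) (x : Fin d → ℝ) : ℂ :=
  Complex.exp (2 * Real.pi * Complex.I * ((∑ j, (k j : ℝ) * x j : ℝ) : ℂ))

/-- The `k`-th Fourier coefficient of `f`. -/
noncomputable def cubeFourierCoeff {d : ℕ} (f : (Fin d → ℝ) → ℝ) (k : Fin d → ℤ) : ℂ :=
  ∫ x in Set.Icc (0 : Fin d → ℝ) 1, (f x : ℂ) * fourierMode (-k) x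

/-- `r_{α,γ}(k) = ∏_{j : k_j ≠ 0} |k_j|^α / γ_j`, with value `∞` if `γ_j = 0` for some `j`
with `k_j ≠ 0` (in `ℝ≥0∞` division of a positive number by `0` is `∞`). -/
noncomputable def korobovR (α : ℝ) (γ : ℕ → ℝ) {d : ℕ} (k : Fin d → ℤ) : ℝ≥0∞ :=
  ∏ j : Fin d, if k j = 0 then 1
    else ENNReal.ofReal (|(k j : ℝ)| ^ α) / ENNReal.ofReal (γ j)

/-- The Korobov norm, with value `∞` outside of the space (in `ℝ≥0∞` one has `0 * ∞ = 0`, so a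
finite norm forces the coefficients with `r_{α,γ}(k) = ∞` to vanish, and these do not
contribute). -/
noncomputable def korobovNorm (α : ℝ) (γ : ℕ → ℝ) {d : ℕ} (f : (Fin d → ℝ) → ℝ) : ℝ≥0∞ :=
  (∑' k : Fin d → ℤ, ‖cubeFourierCoeff f k‖ₑ ^ 2 * korobovR α γ k ^ 2) ^ (1 / 2 : ℝ)

/-- The weighted Korobov space (for `α > 1/2`): real functions, one-periodic in each variable,
that are the sum of their absolutely convergent Fourier series and have finite norm. -/
def korobovSpace (α : ℝ) (γ : ℕ → ℝ) (d : ℕ) : Set ((Fin d → ℝ) → ℝ) :=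
  {f | (∀ x j, f (x + Pi.single j 1) = f x) ∧
    Summable (fun k : Fin d → ℤ => ‖cubeFourierCoeff f k‖) ∧
    (∀ x, (f x : ℂ) = ∑' k : Fin d → ℤ, cubeFourierCoeff f k * fourierMode k x) ∧
    korobovNorm α γ f < ∞}

/-- The closed unit ball of the weighted Korobov space. -/
def korobovBall (α : ℝ) (γ : ℕ → ℝ) (d : ℕ) : Set ((Fin d → ℝ) → ℝ) :=
  {f | f ∈ korobovSpace α γ d ∧ korobovNorm α γ f ≤ 1}

/-- The equal-weight cubature rule with the points `P 0, …, P (N - 1)`. -/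
noncomputable def qmcRule {d N : ℕ} (P : Fin N → Fin d → ℝ) (f : (Fin d → ℝ) → ℝ) : ℝ :=
  (1 / (N : ℝ)) * ∑ n, f (P n)

/-- The rank-1 lattice points `({n z_1 / N}, …, {n z_d / N})`, `0 ≤ n < N`. -/
noncomputable def rankOneLattice {d : ℕ} (N : ℕ) (z : Fin d → ℕ) : Fin N → Fin d → ℝ :=
  fun n j => Int.fract ((n : ℝ) * (z j : ℝ) / (N : ℝ))

/-- The points shifted by `Δ` modulo one. -/
noncomputable def shiftPoints {d N : ℕ} (P : Fin N → Fin d → ℝ) (Δ : Fin d → ℝ) :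
    Fin N → Fin d → ℝ :=
  fun n j => Int.fract (P n j + Δ j)

/-- The worst-case error in the weighted Korobov space of a deterministic rule `Q`. -/
noncomputable def worstCaseError (α : ℝ) (γ : ℕ → ℝ) {d : ℕ}
    (Q : ((Fin d → ℝ) → ℝ) → ℝ) : ℝ≥0∞ :=
  ⨆ f ∈ korobovBall α γ d, ENNReal.ofReal |cubeIntegral f - Q f|

/-- The worst-case root-mean-squared error in the weighted Korobov space of a randomized rule
`(Q ω)` over the probability space `(Ω, μ)`. -/
noncomputable def worstCaseRMSE (α : ℝ) (γ : ℕ → ℝ) {d : ℕ} {Ω : Type*} [MeasurableSpace Ω]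
    (μ : MeasureTheory.Measure Ω) (Q : Ω → ((Fin d → ℝ) → ℝ) → ℝ) : ℝ≥0∞ :=
  ⨆ f ∈ korobovBall α γ d,
    (∫⁻ ω, ENNReal.ofReal (|cubeIntegral f - Q ω f| ^ 2) ∂μ) ^ (1 / 2 : ℝ)

/-- The set of primes `p` with `⌈M/2⌉ < p ≤ M`. -/
def primeRange (M : ℕ) : Set ℕ :=
  {p | p.Prime ∧ ⌈(M : ℝ) / 2⌉₊ < p ∧ p ≤ M}

/-- The set `{1, …, N-1}^d` of generating vectors. -/
def genVectors (d N : ℕ) : Set (Fin d → ℕ) :=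
  {z | ∀ j, 1 ≤ z j ∧ z j ≤ N - 1}

/-- The law of `(N, (z_1, …, z_r))`: `N` is uniform on `primeRange M` and, given `N`, the vectors
`z_1, …, z_r` are independent and uniform on `{1, …, N-1}^d`. -/
noncomputable def drawLaw (d r M : ℕ) : MeasureTheory.Measure (ℕ × (Fin r → Fin d → ℕ)) :=
  (ProbabilityTheory.uniformOn (primeRange M)).bind fun N =>
    (MeasureTheory.Measure.dirac N).prod
      (MeasureTheory.Measure.pi fun _ : Fin r => ProbabilityTheory.uniformOn (genVectors d N))

/-- `sel N Z` is an index of a vector with the smallest worst-case error among the vectors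
`Z 0, …, Z (r - 1)`, for all possible draws; ties may be broken in any way. -/
def IsArgminSelection (α : ℝ) (γ : ℕ → ℝ) (d r M : ℕ)
    (sel : ℕ → (Fin r → Fin d → ℕ) → Fin r) : Prop :=
  ∀ N ∈ primeRange M, ∀ Z : Fin r → Fin d → ℕ, (∀ i, Z i ∈ genVectors d N) →
    ∀ i, worstCaseError α γ (qmcRule (rankOneLattice N (Z (sel N Z)))) ≤
      worstCaseError α γ (qmcRule (rankOneLattice N (Z i)))

/-- The worst-case RMSE of the randomly shifted randomized lattice rule: `N`, `z_1, …, z_r` are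
drawn from `drawLaw`, `z* = z_{sel}`, and the shift is independent and uniform on the unit cube. -/
noncomputable def shiftedLatticeRMSE (α : ℝ) (γ : ℕ → ℝ) (d r M : ℕ)
    (sel : ℕ → (Fin r → Fin d → ℕ) → Fin r) : ℝ≥0∞ :=
  worstCaseRMSE α γ
    ((drawLaw d r M).prod
      (MeasureTheory.volume.restrict (Set.Icc (0 : Fin d → ℝ) 1)))
    (fun ω => qmcRule (shiftPoints
      (rankOneLattice ω.1.1 (ω.1.2 (sel ω.1.1 ω.1.2))) ω.2))

/-- The product `∏_{j=1}^d (1 + 2 γ_j^{1/lam} ζ(α/lam))`. -/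
noncomputable def zetaProduct (α : ℝ) (γ : ℕ → ℝ) (d : ℕ) (lam : ℝ) : ℝ :=
  ∏ j : Fin d, (1 + 2 * γ j ^ (1 / lam) * (riemannZeta ((α / lam : ℝ) : ℂ)).re)

/-- The condition `(1-η) M ≥ inf_{1/2 ≤ lam < α} 2 ∏_{j=1}^d (1 + 2 γ_j^{1/lam} ζ(α/lam))`. -/
def EnoughPoints (α : ℝ) (γ : ℕ → ℝ) (d : ℕ) (η : ℝ) (M : ℕ) : Prop :=
  sInf ((fun lam => 2 * zetaProduct α γ d lam) '' Set.Ico (1 / 2) α) ≤ (1 - η) * (M : ℝ)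

/-- The number of trials `⌈-(2α+1) log M / log (1-η)⌉`. -/
noncomputable def numTrials (α η : ℝ) (M : ℕ) : ℕ :=
  ⌈-(2 * α + 1) * (Real.log M / Real.log (1 - η))⌉₊

/-! Averaging over the uniform shift diagonalises the squared error: by Parseval, the mean squared
error of `f` is at most the sum over `k ≠ 0` of `|f̂(k)|²` times the probability that `k` lies in
the dual lattice of the selected rule. Since `∑ |f̂(k)|² r(k)² ≤ 1`, everything reduces to bounding
that probability divided by `r(k)²`, uniformly in `k` (`shiftedLatticeRMSE_le`).

Fix a threshold `b` of order `M^(-λ)`, chosen by Markov's inequality so that a single random vector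
has worst-case error above `b` with probability at most `1 - η`. There are two kinds of frequencies.

If `1 / r(k) > b`, then `k` in the dual lattice makes a cosine of frequency `k` a bad function, so
the selected vector has error above `b`. By minimality all the independent trials have failed, which
has probability at most `(1 - η)^r ≤ M^(-2α-1)`.

If `1 / r(k) ≤ b`, take `k_j ≠ 0`. When the random prime `N` does not divide `k_j`, a union bound
over the trials gives probability `O(r / M)`. The proportion of primes dividing `k_j` is `O(log
|k_j| / M)`, by a Chebyshev bound and because the product of those primes divides `k_j`. Here `log
|k_j|` is at most a multiple of `r(k)^δ`, and `r(k)^(δ-2) ≤ b^(2-δ)` supplies the remaining power of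
`M`.

The dimension enters only through the sum of `r(k)^(-1/λ)`, which is controlled by `∑ γ_j^(1/λ)`. -/

open MeasureTheory ProbabilityTheory

/-! ### Counting primes between `M / 2` and `M` -/

/-- The primes `p` with `⌈M/2⌉ < p ≤ M`, as a finite set. -/
def upperPrimes (M : ℕ) : Finset ℕ :=
  (Finset.Ioc ((M + 1) / 2) M).filter Nat.Prime

theorem coe_upperPrimes (M : ℕ) : (upperPrimes M : Set ℕ) = primeRange M := by
  have h : ⌈(M : ℝ) / 2⌉₊ = (M + 1) / 2 := by
    apply le_antisymm
    · rw [Nat.ceil_le, div_le_iff₀ two_pos]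
      exact_mod_cast (by omega : M ≤ (M + 1) / 2 * 2)
    · have h1 : (M : ℝ) ≤ (⌈(M : ℝ) / 2⌉₊ : ℝ) * 2 := by
        rw [← div_le_iff₀ two_pos]; exact Nat.le_ceil _
      have h2 : M ≤ ⌈(M : ℝ) / 2⌉₊ * 2 := by exact_mod_cast h1
      omega
  ext p
  simp only [upperPrimes, primeRange, h, Finset.coe_filter, Finset.mem_Ioc, Set.mem_ofPred_eq]
  tauto

theorem mem_upperPrimes {M p : ℕ} : p ∈ upperPrimes M ↔ p ∈ primeRange M := by
  rw [← coe_upperPrimes, Finset.mem_coe]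

theorem upperPrimes_nonempty {M : ℕ} (hM : 2 ≤ M) : (upperPrimes M).Nonempty := by
  obtain ⟨p, hp, h1, h2⟩ := Nat.exists_prime_lt_and_le_two_mul ((M + 1) / 2) (by omega)
  refine ⟨p, Finset.mem_filter.2 ⟨Finset.mem_Ioc.2 ⟨h1, ?_⟩, hp⟩⟩
  -- Bertrand's postulate could overshoot only to `p = M + 1` with `M` odd, and that number is even
  -- and larger than 2.
  by_contra hlt
  have hpM : p = 2 * ((M + 1) / 2) := by omega
  rcases hp.eq_one_or_self_of_dvd 2 ⟨_, hpM⟩ with h | h <;> omega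

theorem two_mul_gt_of_mem_upperPrimes {M p : ℕ} (hp : p ∈ upperPrimes M) : M < 2 * p := by
  have := Finset.mem_Ioc.1 (Finset.mem_filter.1 hp).1
  omega

/-- An upper bound for the central binomial coefficient in terms of the number of primes between
`n` and `2 n`. -/
theorem centralBinom_le_mul_pow_card_primes (n : ℕ) (hn : 2 < n) :
    n.centralBinom ≤ (2 * n) ^ Nat.sqrt (2 * n) * 4 ^ (2 * n / 3) *
      (2 * n) ^ ((Finset.Ioc n (2 * n)).filter Nat.Prime).card := by
  set S := (Finset.range (2 * n + 1)).filter Nat.Prime with hS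
  set f : ℕ → ℕ := fun p => p ^ n.centralBinom.factorization p with hf
  have h0 : n.centralBinom = ∏ p ∈ S, f p := by
    conv_lhs => rw [← n.prod_pow_factorization_centralBinom]
    symm
    refine Finset.prod_filter_of_ne fun p _ h => ?_
    contrapose h
    rw [hf]
    simp only
    rw [Nat.factorization_eq_zero_of_not_prime n.centralBinom h, pow_zero]
  -- Erdős's splitting of the central binomial coefficient: primes up to `√(2n)` contribute at most
  -- `2n` each, those from there to `2n/3` occur at most once, those in `(2n/3, n]` do not occur,
  -- and those above `n` contribute at most `2n` each.
  have h1 : ∀ p ∈ S, f p ≤ (if p ≤ Nat.sqrt (2 * n) then 2 * n else 1) *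
      (if p ≤ 2 * n / 3 then p else 1) * (if n < p then 2 * n else 1) := by
    intro p hp
    have hpp : p.Prime := (Finset.mem_filter.1 hp).2
    have hp1 := hpp.one_lt
    have hle : f p ≤ 2 * n := Nat.pow_factorization_choose_le (by omega)
    by_cases ha : p ≤ Nat.sqrt (2 * n)
    · rw [if_pos ha, mul_assoc]
      refine hle.trans (Nat.le_mul_of_pos_right _ ?_)
      split_ifs <;> positivity
    · rw [if_neg ha, one_mul]
      by_cases hc : n < p
      · rw [if_pos hc]
        refine hle.trans (Nat.le_mul_of_pos_left _ ?_)
        split_ifs <;> omega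
      · rw [if_neg hc, mul_one]
        by_cases hb : p ≤ 2 * n / 3
        · rw [if_pos hb]
          refine (pow_right_mono₀ hp1.le ?_).trans (pow_one p).le
          exact Nat.factorization_choose_le_one (Nat.sqrt_lt'.mp <| not_le.1 ha)
        · rw [if_neg hb]
          refine le_of_eq ?_
          simp only [hf]
          rw [Nat.factorization_centralBinom_of_two_mul_self_lt_three_mul hn (by omega) (by omega),
            pow_zero]
  rw [h0]
  refine (Finset.prod_le_prod' h1).trans ?_
  rw [Finset.prod_mul_distrib, Finset.prod_mul_distrib]
  refine Nat.mul_le_mul (Nat.mul_le_mul ?_ ?_) ?_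
  · rw [← Finset.prod_filter, Finset.prod_const]
    refine Nat.pow_le_pow_right (by omega) ?_
    have : (Finset.Icc 1 (Nat.sqrt (2 * n))).card = Nat.sqrt (2 * n) := by simp
    refine (Finset.card_le_card fun x hx => ?_).trans this.le
    obtain ⟨h1, h2⟩ := Finset.mem_filter.1 hx
    exact Finset.mem_Icc.mpr ⟨(Finset.mem_filter.1 h1).2.one_lt.le, h2⟩
  · refine le_trans ?_ (primorial_le_four_pow (2 * n / 3))
    rw [← Finset.prod_filter]
    refine Finset.prod_le_prod_of_subset_of_one_le' ?_ ?_
    · intro p hp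
      simp only [hS, Finset.mem_filter, Finset.mem_range] at hp ⊢
      exact ⟨by omega, hp.1.2⟩
    · exact fun p hp _ => (Finset.mem_filter.1 hp).2.one_lt.le
  · rw [← Finset.prod_filter, Finset.prod_const]
    refine Nat.pow_le_pow_right (by omega) (Finset.card_le_card fun p hp => ?_)
    simp only [hS, Finset.mem_filter, Finset.mem_range, Finset.mem_Ioc] at hp ⊢
    exact ⟨⟨hp.2, by omega⟩, hp.1.2⟩

/-- The intervals start at `⌊M/2⌋` and `⌈M/2⌉`, so for odd `M` one possible prime is lost. -/
theorem card_primes_Ioc_half_le (M : ℕ) :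
    ((Finset.Ioc (M / 2) (2 * (M / 2))).filter Nat.Prime).card ≤ (upperPrimes M).card + 1 := by
  refine le_trans (Finset.card_le_card (t := insert (M / 2 + 1) (upperPrimes M)) ?_)
    (Finset.card_insert_le _ _)
  intro p hp
  simp only [upperPrimes, Finset.mem_filter, Finset.mem_Ioc, Finset.mem_insert] at hp ⊢
  by_cases h : p = M / 2 + 1
  · exact Or.inl h
  · exact Or.inr ⟨⟨by omega, by omega⟩, hp.2⟩

/-- The Chebyshev-type inequality behind the lower bound for the number of primes between `M / 2`
and `M`. -/
theorem sub_one_div_six_le (M : ℕ) (hM : 8 ≤ M) :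
    ((M : ℝ) - 1) / 6 ≤ (2 + √M + (upperPrimes M).card) * Real.log M := by
  set n := M / 2 with hn
  have hn4 : 4 ≤ n := by omega
  set K := ((Finset.Ioc n (2 * n)).filter Nat.Prime).card with hK
  have h1 : 4 ^ n ≤ n * ((2 * n) ^ Nat.sqrt (2 * n) * 4 ^ (2 * n / 3) * (2 * n) ^ K) :=
    (Nat.four_pow_lt_mul_centralBinom n hn4).le.trans
      (Nat.mul_le_mul_left _ (centralBinom_le_mul_pow_card_primes n (by omega)))
  have hn0 : (0 : ℝ) < n := by exact_mod_cast (by omega : 0 < n)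
  have h2 : (n : ℝ) * Real.log 4 ≤ Real.log n + (Nat.sqrt (2 * n) * Real.log (2 * n) +
      (2 * n / 3 : ℕ) * Real.log 4 + K * Real.log (2 * n)) := by
    have h1' : (4 : ℝ) ^ n ≤ n * ((2 * n) ^ Nat.sqrt (2 * n) * 4 ^ (2 * n / 3) * (2 * n) ^ K) := by
      exact_mod_cast h1
    have := Real.log_le_log (by positivity) h1'
    rwa [Real.log_pow, Real.log_mul (by positivity) (by positivity),
      Real.log_mul (by positivity) (by positivity), Real.log_mul (by positivity) (by positivity),
      Real.log_pow, Real.log_pow, Real.log_pow] at this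
  have hx : (2 * n : ℝ) ≤ M := by exact_mod_cast (by omega : 2 * n ≤ M)
  have hx' : (M : ℝ) ≤ 2 * n + 1 := by exact_mod_cast (by omega : M ≤ 2 * n + 1)
  have hM0 : (0 : ℝ) < M := by linarith
  have hl1 : Real.log n ≤ Real.log M := Real.log_le_log hn0 (by linarith)
  have hl2 : Real.log (2 * n) ≤ Real.log M := Real.log_le_log (by linarith) hx
  have hlM : 0 ≤ Real.log M := Real.log_natCast_nonneg M
  have hs : (Nat.sqrt (2 * n) : ℝ) ≤ √M :=
    Real.nat_sqrt_le_real_sqrt.trans (Real.sqrt_le_sqrt (by push_cast; exact hx))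
  have hK' : (K : ℝ) ≤ (upperPrimes M).card + 1 := by exact_mod_cast card_primes_Ioc_half_le M
  have hl4 : 1 ≤ Real.log 4 := by
    rw [Real.le_log_iff_exp_le (by norm_num)]
    linarith [Real.exp_one_lt_d9]
  have hd : ((2 * n / 3 : ℕ) : ℝ) ≤ 2 * n / 3 := by
    have := @Nat.cast_div_le ℝ _ _ _ (2 * n) 3
    push_cast at this ⊢; exact this
  have e1 : (Nat.sqrt (2 * n) : ℝ) * Real.log (2 * n) ≤ √M * Real.log M := by
    apply mul_le_mul hs hl2 (Real.log_nonneg _) (Real.sqrt_nonneg _)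
    have : (4 : ℝ) ≤ n := by exact_mod_cast hn4
    linarith
  have e2 : (K : ℝ) * Real.log (2 * n) ≤ ((upperPrimes M).card + 1) * Real.log M := by
    apply mul_le_mul hK' hl2 (Real.log_nonneg _) (by positivity)
    have : (4 : ℝ) ≤ n := by exact_mod_cast hn4
    linarith
  have e3 : ((2 * n / 3 : ℕ) : ℝ) * Real.log 4 ≤ 2 * n / 3 * Real.log 4 := by gcongr
  -- Of `n log 4`, the primorial term absorbs two thirds; what remains is at least `n / 3 ≥ (M - 1)
  -- / 6`.
  have e4 : (n : ℝ) / 3 ≤ n / 3 * Real.log 4 := le_mul_of_one_le_right (by positivity) hl4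
  nlinarith

/-- A lower bound of Chebyshev type for the number of primes between `M / 2` and `M`. -/
theorem exists_mul_le_card_upperPrimes_mul_log :
    ∃ c : ℝ, 0 < c ∧ ∀ M : ℕ, 2 ≤ M → c * M ≤ (upperPrimes M).card * Real.log M := by
  -- With `log M ≤ √M / 72` the error term `(2 + √M) log M` is at most `M / 24`, leaving at least `M
  -- / 12` for `M ≥ 8`. Smaller `M` are covered by the single prime from Bertrand's postulate.
  have hlo := (isLittleO_log_rpow_atTop (r := 1 / 2) (by norm_num)).bound
    (show (0 : ℝ) < 1 / 72 by norm_num)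
  obtain ⟨X, hX⟩ := Filter.eventually_atTop.1 hlo
  obtain ⟨M₀, hM₀⟩ := exists_nat_ge (max X 8)
  have hM₀8 : 8 ≤ M₀ := by exact_mod_cast (le_max_right X 8).trans hM₀
  have hM₀p : (0 : ℝ) < M₀ := by exact_mod_cast (by omega : 0 < M₀)
  have hl2 : 0 < Real.log 2 := Real.log_pos one_lt_two
  refine ⟨min (1 / 12) (Real.log 2 / M₀), by positivity, fun M hM => ?_⟩
  have hMp : (2 : ℝ) ≤ M := by exact_mod_cast hM
  by_cases hlt : M < M₀
  · have h1 : (1 : ℝ) ≤ (upperPrimes M).card := by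
      exact_mod_cast Finset.card_pos.2 (upperPrimes_nonempty hM)
    have h2 : Real.log 2 ≤ Real.log M := Real.log_le_log two_pos hMp
    calc min (1 / 12) (Real.log 2 / M₀) * M ≤ Real.log 2 / M₀ * M₀ := by
          have : (M : ℝ) ≤ M₀ := by exact_mod_cast hlt.le
          gcongr
          exact min_le_right _ _
      _ = 1 * Real.log 2 := by field_simp
      _ ≤ _ := by gcongr
  · have hge : (M₀ : ℝ) ≤ M := by exact_mod_cast not_lt.1 hlt
    have h8 : (8 : ℝ) ≤ M := le_trans (by exact_mod_cast hM₀8) hge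
    have h1 := sub_one_div_six_le M (by exact_mod_cast h8)
    have h2 := hX M (((le_max_left X 8).trans hM₀).trans hge)
    rw [Real.norm_of_nonneg (Real.log_natCast_nonneg M), Real.norm_of_nonneg (by positivity),
      ← Real.sqrt_eq_rpow] at h2
    have h3 : √(M : ℝ) * √M = M := Real.mul_self_sqrt (by positivity)
    have h4 : 1 ≤ √(M : ℝ) := Real.one_le_sqrt.2 (by linarith)
    have h5 : (2 + √(M : ℝ)) * Real.log M ≤ (3 * √M) * (1 / 72 * √M) := by
      apply mul_le_mul (by linarith) h2 (Real.log_natCast_nonneg M) (by positivity)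
    have h6 : min (1 / 12) (Real.log 2 / M₀) * M ≤ 1 / 12 * M := by
      gcongr; exact min_le_left _ _
    nlinarith

/-- A nonzero integer has few divisors among the primes between `M / 2` and `M`. -/
theorem card_filter_dvd_upperPrimes_mul_log_le {M : ℕ} (hM : 2 ≤ M) {m : ℤ} (hm : m ≠ 0) :
    (((upperPrimes M).filter fun p : ℕ => (p : ℤ) ∣ m).card : ℝ) * Real.log M ≤
      2 * Real.log |(m : ℝ)| := by
  set S := (upperPrimes M).filter fun p : ℕ => (p : ℤ) ∣ m
  have hdvd : ∏ p ∈ S, p ∣ m.natAbs := by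
    refine Finset.prod_primes_dvd _ (fun p hp => ?_) fun p hp => ?_
    · exact (Finset.mem_filter.1 (Finset.mem_filter.1 hp).1).2.prime
    · exact Int.natCast_dvd.1 (Finset.mem_filter.1 hp).2
  -- Each such prime satisfies `M < 2 p ≤ p ^ 2`, and their product divides `m`.
  have hle : M ^ S.card ≤ m.natAbs ^ 2 := by
    calc M ^ S.card = ∏ p ∈ S, M := (Finset.prod_const _).symm
      _ ≤ ∏ p ∈ S, p ^ 2 := by
        refine Finset.prod_le_prod' fun p hp => ?_
        have hp' := (Finset.mem_filter.1 hp).1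
        have h1 := two_mul_gt_of_mem_upperPrimes hp'
        have h2 := (Finset.mem_filter.1 hp').2.two_le
        nlinarith
      _ = (∏ p ∈ S, p) ^ 2 := Finset.prod_pow _ _ _
      _ ≤ m.natAbs ^ 2 := Nat.pow_le_pow_left (Nat.le_of_dvd (Int.natAbs_pos.2 hm) hdvd) 2
  have hle' : (M : ℝ) ^ S.card ≤ |(m : ℝ)| ^ 2 := by
    rw [← Int.cast_abs, Int.abs_eq_natAbs]
    exact_mod_cast hle
  have := Real.log_le_log (by positivity) hle'
  rwa [Real.log_pow, Real.log_pow] at this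

/-- The proportion of the primes between `M / 2` and `M` that divide a given nonzero integer. -/
theorem exists_card_filter_dvd_div_card_le :
    ∃ c : ℝ, 0 < c ∧ ∀ M : ℕ, 2 ≤ M → ∀ m : ℤ, m ≠ 0 →
      (((upperPrimes M).filter fun p : ℕ => (p : ℤ) ∣ m).card : ℝ) / (upperPrimes M).card ≤
        c * Real.log |(m : ℝ)| / M := by
  obtain ⟨c, hc, h⟩ := exists_mul_le_card_upperPrimes_mul_log
  refine ⟨2 / c, by positivity, fun M hM m hm => ?_⟩
  have hP : (0 : ℝ) < (upperPrimes M).card := by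
    exact_mod_cast Finset.card_pos.2 (upperPrimes_nonempty hM)
  have hMp : (0 : ℝ) < M := by exact_mod_cast (by omega : 0 < M)
  have h1 := card_filter_dvd_upperPrimes_mul_log_le hM hm
  have h2 := h M hM
  set t : ℝ := (((upperPrimes M).filter fun p : ℕ => (p : ℤ) ∣ m).card : ℝ) with ht
  have ht0 : 0 ≤ t := Nat.cast_nonneg _
  have h3 : t * (c * M) ≤ (upperPrimes M).card * (2 * Real.log |(m : ℝ)|) := by
    calc t * (c * M) ≤ t * ((upperPrimes M).card * Real.log M) := by gcongr
      _ = (upperPrimes M).card * (t * Real.log M) := by ring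
      _ ≤ _ := by gcongr
  rw [div_le_div_iff₀ hP hMp, div_mul_eq_mul_div, div_mul_eq_mul_div, le_div_iff₀ hc]
  nlinarith

/-! ### Absolutely convergent Fourier series on the cube -/

section FourierMode

variable {d : ℕ}

theorem fourierMode_zero (x : Fin d → ℝ) : fourierMode 0 x = 1 := by simp [fourierMode]

theorem fourierMode_add (k l : Fin d → ℤ) (x : Fin d → ℝ) :
    fourierMode (k + l) x = fourierMode k x * fourierMode l x := by
  rw [fourierMode, fourierMode, fourierMode, ← Complex.exp_add, ← mul_add, ← Complex.ofReal_add,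
    ← Finset.sum_add_distrib]
  simp [add_mul]

theorem fourierMode_add_right (k : Fin d → ℤ) (x y : Fin d → ℝ) :
    fourierMode k (x + y) = fourierMode k x * fourierMode k y := by
  rw [fourierMode, fourierMode, fourierMode, ← Complex.exp_add, ← mul_add, ← Complex.ofReal_add,
    ← Finset.sum_add_distrib]
  simp [mul_add]

theorem norm_fourierMode (k : Fin d → ℤ) (x : Fin d → ℝ) : ‖fourierMode k x‖ = 1 := by
  rw [fourierMode, show (2 * Real.pi * Complex.I * ((∑ j, (k j : ℝ) * x j : ℝ) : ℂ)) =
    ((2 * Real.pi * ∑ j, (k j : ℝ) * x j : ℝ) : ℂ) * Complex.I by push_cast; ring]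
  exact Complex.norm_exp_ofReal_mul_I _

theorem star_fourierMode (k : Fin d → ℤ) (x : Fin d → ℝ) :
    starRingEnd ℂ (fourierMode k x) = fourierMode (-k) x := by
  rw [fourierMode, fourierMode, ← Complex.exp_conj]
  congr 1
  simp only [map_mul, Complex.conj_I, Complex.conj_ofReal, map_ofNat]
  simp

theorem continuous_fourierMode (k : Fin d → ℤ) : Continuous (fourierMode k) := by
  unfold fourierMode
  fun_prop

theorem fourierMode_intCast (k m : Fin d → ℤ) : fourierMode k (fun j => (m j : ℝ)) = 1 := by
  rw [fourierMode, Complex.exp_eq_one_iff]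
  exact ⟨∑ j, k j * m j, by push_cast; ring⟩

theorem fourierMode_fract (k : Fin d → ℤ) (x : Fin d → ℝ) :
    fourierMode k (fun j => Int.fract (x j)) = fourierMode k x := by
  have h : x = (fun j => Int.fract (x j)) + fun j => ((⌊x j⌋ : ℤ) : ℝ) := by
    ext j; simp
  conv_rhs => rw [h, fourierMode_add_right, fourierMode_intCast, mul_one]

theorem restrict_cube :
    (volume : Measure (Fin d → ℝ)).restrict (Set.Icc 0 1) =
      Measure.pi fun _ : Fin d => (volume : Measure ℝ).restrict (Set.Icc 0 1) := by
  rw [← Measure.restrict_pi_pi, Set.pi_univ_Icc]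
  rfl

instance isProbabilityMeasure_restrict_cube :
    IsProbabilityMeasure ((volume : Measure (Fin d → ℝ)).restrict (Set.Icc 0 1)) := by
  rw [restrict_cube]
  have : IsProbabilityMeasure ((volume : Measure ℝ).restrict (Set.Icc 0 1)) := ⟨by simp⟩
  infer_instance

theorem integral_exp_two_pi_I_mul (m : ℤ) :
    ∫ t in Set.Icc (0 : ℝ) 1, Complex.exp (2 * Real.pi * Complex.I * ((m * t : ℝ) : ℂ)) =
      if m = 0 then 1 else 0 := by
  split_ifs with h
  · simp [h]
  · have hc : (2 * Real.pi * Complex.I * m : ℂ) ≠ 0 := by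
      simp [Real.pi_ne_zero, h]
    rw [integral_Icc_eq_integral_Ioc, ← intervalIntegral.integral_of_le zero_le_one]
    have := integral_exp_mul_complex (a := 0) (b := 1) hc
    have he : Complex.exp (2 * Real.pi * Complex.I * m) = 1 :=
      Complex.exp_eq_one_iff.2 ⟨m, by ring⟩
    simp only [Complex.ofReal_one, mul_one, Complex.ofReal_zero, mul_zero, Complex.exp_zero, he,
      sub_self, zero_div] at this
    rw [← this]
    congr 1
    ext t
    push_cast
    ring_nf

theorem integral_fourierMode (k : Fin d → ℤ) :
    ∫ x in Set.Icc (0 : Fin d → ℝ) 1, fourierMode k x = if k = 0 then 1 else 0 := by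
  have h : ∀ x : Fin d → ℝ, fourierMode k x =
      ∏ j, Complex.exp (2 * Real.pi * Complex.I * ((k j * x j : ℝ) : ℂ)) := by
    intro x
    rw [← Complex.exp_sum, fourierMode, Complex.ofReal_sum, Finset.mul_sum]
  simp_rw [h]
  rw [restrict_cube, integral_fintype_prod_eq_prod
    (f := fun j t => Complex.exp (2 * Real.pi * Complex.I * ((k j * t : ℝ) : ℂ)))]
  simp_rw [integral_exp_two_pi_I_mul]
  split_ifs with hk
  · simp [hk]
  · obtain ⟨j, hj⟩ := Function.ne_iff.1 hk
    exact Finset.prod_eq_zero (Finset.mem_univ j) (if_neg hj)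

variable {c : (Fin d → ℤ) → ℂ}

theorem summable_mul_fourierMode (hc : Summable fun k => ‖c k‖) (x : Fin d → ℝ) :
    Summable fun k => c k * fourierMode k x := by
  refine Summable.of_norm ?_
  simpa [norm_fourierMode] using hc

theorem continuous_tsum_fourierMode (hc : Summable fun k => ‖c k‖) :
    Continuous fun x => ∑' k, c k * fourierMode k x :=
  continuous_tsum (fun k => continuous_const.mul (continuous_fourierMode k)) hc
    fun k x => by simp [norm_fourierMode]

theorem integrable_cube_of_continuous {g : (Fin d → ℝ) → ℂ} (hg : Continuous g) :
    IntegrableOn g (Set.Icc (0 : Fin d → ℝ) 1) :=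
  hg.continuousOn.integrableOn_compact isCompact_Icc

/-- Absolute convergence permits termwise integration. A character as `g` yields the Fourier
coefficients, the conjugate of the series itself yields Parseval. -/
theorem integral_tsum_fourierMode_mul (hc : Summable fun k => ‖c k‖) {g : (Fin d → ℝ) → ℂ}
    (hg : Continuous g) {b : ℝ} (hb : ∀ x, ‖g x‖ ≤ b) :
    ∫ x in Set.Icc (0 : Fin d → ℝ) 1, (∑' k, c k * fourierMode k x) * g x =
      ∑' k, c k * ∫ x in Set.Icc (0 : Fin d → ℝ) 1, fourierMode k x * g x := by
  have hb0 : 0 ≤ b := (norm_nonneg _).trans (hb 0)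
  have hF : ∀ k, IntegrableOn (fun x => c k * fourierMode k x * g x)
      (Set.Icc (0 : Fin d → ℝ) 1) := fun k =>
    integrable_cube_of_continuous ((continuous_const.mul (continuous_fourierMode k)).mul hg)
  have hs : Summable fun k => ∫ x in Set.Icc (0 : Fin d → ℝ) 1, ‖c k * fourierMode k x * g x‖ := by
    refine Summable.of_nonneg_of_le (fun k => integral_nonneg fun x => norm_nonneg _)
      (fun k => ?_) (hc.mul_right b)
    calc ∫ x in Set.Icc (0 : Fin d → ℝ) 1, ‖c k * fourierMode k x * g x‖
        ≤ ∫ _ in Set.Icc (0 : Fin d → ℝ) 1, ‖c k‖ * b := by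
          refine integral_mono (hF k).norm (integrable_const _) fun x => ?_
          simp only [norm_mul, norm_fourierMode, mul_one]
          exact mul_le_mul_of_nonneg_left (hb x) (norm_nonneg _)
      _ = ‖c k‖ * b := by simp
  have := (hasSum_integral_of_summable_integral_norm hF hs).tsum_eq
  simp_rw [← tsum_mul_right]
  rw [← this]
  congr 1
  ext k
  rw [← integral_const_mul]
  simp_rw [mul_assoc]

/-- The Fourier coefficients of an absolutely convergent Fourier series. -/
theorem integral_tsum_fourierMode_mul_fourierMode_neg (hc : Summable fun k => ‖c k‖)
    (l : Fin d → ℤ) :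
    ∫ x in Set.Icc (0 : Fin d → ℝ) 1, (∑' k, c k * fourierMode k x) * fourierMode (-l) x = c l := by
  rw [integral_tsum_fourierMode_mul hc (continuous_fourierMode _)
    (fun x => (norm_fourierMode _ x).le)]
  simp_rw [← fourierMode_add, integral_fourierMode]
  rw [tsum_eq_single l]
  · simp
  · intro k hk
    rw [if_neg, mul_zero]
    rwa [← sub_eq_add_neg, sub_eq_zero]

/-- Parseval's identity for absolutely convergent Fourier series. -/
theorem lintegral_enorm_tsum_fourierMode_sq (hc : Summable fun k => ‖c k‖) :
    ∫⁻ x in Set.Icc (0 : Fin d → ℝ) 1, ‖∑' k, c k * fourierMode k x‖ₑ ^ 2 =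
      ∑' k, ‖c k‖ₑ ^ 2 := by
  set g : (Fin d → ℝ) → ℂ := fun x => ∑' k, c k * fourierMode k x with hgdef
  have hg : Continuous g := continuous_tsum_fourierMode hc
  have hb : ∀ x, ‖g x‖ ≤ ∑' k, ‖c k‖ := fun x => by
    refine (norm_tsum_le_tsum_norm ?_).trans_eq ?_ <;> simp [norm_fourierMode, hc]
  have hsq : Summable fun k => ‖c k‖ ^ 2 := by
    refine Summable.of_nonneg_of_le (fun k => by positivity) (fun k => ?_)
      (hc.mul_left (∑' k, ‖c k‖))
    rw [sq]
    exact mul_le_mul_of_nonneg_right (hc.le_tsum k fun _ _ => norm_nonneg _) (norm_nonneg _)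
  have h1 : ∫ x in Set.Icc (0 : Fin d → ℝ) 1, g x * starRingEnd ℂ (g x) =
      ∑' k, c k * starRingEnd ℂ (c k) := by
    have := integral_tsum_fourierMode_mul hc (g := fun x => starRingEnd ℂ (g x))
      (Complex.continuous_conj.comp hg) (b := ∑' k, ‖c k‖) (fun x => by simpa using hb x)
    rw [this]
    congr 1
    ext k
    congr 1
    rw [← integral_tsum_fourierMode_mul_fourierMode_neg hc k, ← integral_conj]
    refine integral_congr_ae (Filter.Eventually.of_forall fun x => ?_)
    simp only [map_mul, star_fourierMode, neg_neg]
    rw [mul_comm]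
  have h2 : ∫ x in Set.Icc (0 : Fin d → ℝ) 1, ‖g x‖ ^ 2 = ∑' k, ‖c k‖ ^ 2 := by
    simp_rw [Complex.mul_conj, Complex.normSq_eq_norm_sq] at h1
    rw [integral_complex_ofReal, ← Complex.ofReal_tsum] at h1
    exact_mod_cast h1
  have hint : IntegrableOn (fun x => ‖g x‖ ^ 2) (Set.Icc (0 : Fin d → ℝ) 1) :=
    (by fun_prop : Continuous fun x => ‖g x‖ ^ 2).continuousOn.integrableOn_compact isCompact_Icc
  have h3 := ofReal_integral_eq_lintegral_ofReal hint
    (Filter.Eventually.of_forall fun x => sq_nonneg _)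
  rw [h2, ENNReal.ofReal_tsum_of_nonneg (fun k => by positivity) hsq] at h3
  simp_rw [ENNReal.ofReal_pow (norm_nonneg _), ofReal_norm] at h3
  exact h3.symm

end FourierMode

/-! ### Dual lattices and the error of shifted lattice rules -/

/-- The frequency `k` belongs to the dual lattice of the rank-1 lattice generated by `z / N`. -/
def InDualLattice {d : ℕ} (N : ℕ) (z : Fin d → ℕ) (k : Fin d → ℤ) : Prop :=
  (N : ℤ) ∣ ∑ j, k j * (z j : ℤ)

section LatticeRule

variable {d : ℕ}

theorem shiftPoints_rankOneLattice_zero (N : ℕ) (z : Fin d → ℕ) :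
    shiftPoints (rankOneLattice N z) 0 = rankOneLattice N z := by
  ext n j
  simp [shiftPoints, rankOneLattice]

/-- Characters do not see fractional parts, so along the lattice points they form a geometric
progression. -/
theorem fourierMode_shiftPoints_rankOneLattice {N : ℕ} (z : Fin d → ℕ) (Δ : Fin d → ℝ)
    (k : Fin d → ℤ) (n : Fin N) :
    fourierMode k (shiftPoints (rankOneLattice N z) Δ n) = fourierMode k Δ *
      Complex.exp (2 * Real.pi * Complex.I * ((∑ j, k j * (z j : ℤ) : ℤ) / N)) ^ (n : ℕ) := by
  have h : shiftPoints (rankOneLattice N z) Δ n =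
      fun j => Int.fract (((fun j => Int.fract ((n : ℝ) * (z j : ℝ) / (N : ℝ))) + Δ) j) := rfl
  rw [h, fourierMode_fract, fourierMode_add_right,
    fourierMode_fract k (fun j => (n : ℝ) * (z j : ℝ) / (N : ℝ)), mul_comm, ← Complex.exp_nat_mul]
  congr 1
  rw [fourierMode]
  congr 1
  push_cast
  rw [Finset.sum_div, Finset.mul_sum, Finset.mul_sum, Finset.mul_sum]
  refine Finset.sum_congr rfl fun j _ => ?_
  ring

/-- The character property of rank-1 lattices. -/
theorem sum_fourierMode_rankOneLattice {N : ℕ} (hN : N ≠ 0) (z : Fin d → ℕ) (Δ : Fin d → ℝ)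
    (k : Fin d → ℤ) [Decidable (InDualLattice N z k)] :
    (1 / (N : ℂ)) * ∑ n, fourierMode k (shiftPoints (rankOneLattice N z) Δ n) =
      if InDualLattice N z k then fourierMode k Δ else 0 := by
  have hN' : (N : ℂ) ≠ 0 := Nat.cast_ne_zero.2 hN
  simp_rw [fourierMode_shiftPoints_rankOneLattice]
  rw [← Finset.mul_sum, Fin.sum_univ_eq_sum_range (fun n =>
    Complex.exp (2 * Real.pi * Complex.I * ((∑ j, k j * (z j : ℤ) : ℤ) / N)) ^ n)]
  set m : ℤ := ∑ j, k j * (z j : ℤ) with hm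
  split_ifs with h
  · obtain ⟨q, hq⟩ : (N : ℤ) ∣ m := h
    have h1 : Complex.exp (2 * Real.pi * Complex.I * (m / N)) = 1 := by
      rw [Complex.exp_eq_one_iff]
      refine ⟨q, ?_⟩
      rw [hq]
      push_cast
      field_simp
    rw [h1]
    simp only [one_pow, Finset.sum_const, Finset.card_range, nsmul_eq_mul, mul_one]
    field_simp
  · have h1 : Complex.exp (2 * Real.pi * Complex.I * (m / N)) ≠ 1 := by
      intro h1
      obtain ⟨q, hq⟩ := Complex.exp_eq_one_iff.1 h1
      apply h
      refine ⟨q, ?_⟩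
      have hpi : (2 * Real.pi * Complex.I : ℂ) ≠ 0 := by simp [Real.pi_ne_zero]
      have h2 : (m : ℂ) / N = q := by
        apply mul_left_cancel₀ hpi
        rw [hq]; ring
      rw [div_eq_iff hN'] at h2
      have h3 : m = q * N := by exact_mod_cast h2
      rw [← hm, h3, mul_comm]
    have h2 : Complex.exp (2 * Real.pi * Complex.I * (m / N)) ^ N = 1 := by
      rw [← Complex.exp_nat_mul, Complex.exp_eq_one_iff]
      exact ⟨m, by field_simp⟩
    rw [geom_sum_eq h1, h2]
    simp

theorem cubeFourierCoeff_zero (f : (Fin d → ℝ) → ℝ) :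
    cubeFourierCoeff f 0 = (cubeIntegral f : ℂ) := by
  simp only [cubeFourierCoeff, neg_zero, fourierMode_zero, mul_one, cubeIntegral]
  exact integral_complex_ofReal

open scoped Classical in
/-- The Fourier coefficients that a lattice rule with generating vector `z` integrates wrongly. -/
noncomputable def aliasedCoeff (N : ℕ) (z : Fin d → ℕ) (f : (Fin d → ℝ) → ℝ) (k : Fin d → ℤ) : ℂ :=
  if k ≠ 0 ∧ InDualLattice N z k then cubeFourierCoeff f k else 0

theorem norm_aliasedCoeff_le (N : ℕ) (z : Fin d → ℕ) (f : (Fin d → ℝ) → ℝ) (k : Fin d → ℤ) :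
    ‖aliasedCoeff N z f k‖ ≤ ‖cubeFourierCoeff f k‖ := by
  unfold aliasedCoeff
  split_ifs <;> simp

/-- The error of a shifted lattice rule as a Fourier series in the shift. -/
theorem qmcRule_sub_cubeIntegral {N : ℕ} (hN : N ≠ 0) (z : Fin d → ℕ) (Δ : Fin d → ℝ)
    {f : (Fin d → ℝ) → ℝ} (hs : Summable fun k : Fin d → ℤ => ‖cubeFourierCoeff f k‖)
    (hf : ∀ x, (f x : ℂ) = ∑' k : Fin d → ℤ, cubeFourierCoeff f k * fourierMode k x) :
    ((qmcRule (shiftPoints (rankOneLattice N z) Δ) f - cubeIntegral f : ℝ) : ℂ) =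
      ∑' k, aliasedCoeff N z f k * fourierMode k Δ := by
  classical
  have h1 : ((qmcRule (shiftPoints (rankOneLattice N z) Δ) f : ℝ) : ℂ) =
      ∑' k, cubeFourierCoeff f k * (if InDualLattice N z k then fourierMode k Δ else 0) := by
    simp only [qmcRule, Complex.ofReal_mul, Complex.ofReal_sum, hf]
    rw [← Summable.tsum_finsetSum (fun n _ => summable_mul_fourierMode hs _), ← tsum_mul_left]
    refine tsum_congr fun k => ?_
    rw [← sum_fourierMode_rankOneLattice hN, ← Finset.mul_sum]
    push_cast
    ring
  have hsd : Summable fun k => cubeFourierCoeff f k *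
      (if InDualLattice N z k then fourierMode k Δ else 0) := by
    refine Summable.of_norm_bounded hs fun k => ?_
    split_ifs <;> simp [norm_fourierMode]
  rw [Complex.ofReal_sub, h1, ← cubeFourierCoeff_zero]
  have h2 : ∑' k : Fin d → ℤ, (if k = 0 then cubeFourierCoeff f 0 else 0) =
      cubeFourierCoeff f 0 := tsum_ite_eq _ _
  have hs0 : Summable fun k : Fin d → ℤ => if k = 0 then cubeFourierCoeff f 0 else 0 :=
    (hasSum_ite_eq _ _).summable
  rw [← h2, ← hsd.tsum_sub hs0]
  refine tsum_congr fun k => ?_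
  unfold aliasedCoeff
  by_cases hk : k = 0
  · subst hk
    simp [InDualLattice, fourierMode_zero]
  · by_cases hd : InDualLattice N z k <;> simp [hk, hd]

/-- The error is a Fourier series in the shift, so Parseval removes all interaction between
frequencies. -/
theorem lintegral_shift_sq_error {N : ℕ} (hN : N ≠ 0) (z : Fin d → ℕ)
    {f : (Fin d → ℝ) → ℝ} (hs : Summable fun k : Fin d → ℤ => ‖cubeFourierCoeff f k‖)
    (hf : ∀ x, (f x : ℂ) = ∑' k : Fin d → ℤ, cubeFourierCoeff f k * fourierMode k x) :
    ∫⁻ Δ in Set.Icc (0 : Fin d → ℝ) 1, ENNReal.ofReal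
        (|cubeIntegral f - qmcRule (shiftPoints (rankOneLattice N z) Δ) f| ^ 2) =
      ∑' k, ‖aliasedCoeff N z f k‖ₑ ^ 2 := by
  rw [← lintegral_enorm_tsum_fourierMode_sq
    (Summable.of_nonneg_of_le (fun _ => norm_nonneg _) (norm_aliasedCoeff_le N z f) hs)]
  refine lintegral_congr fun Δ => ?_
  rw [← qmcRule_sub_cubeIntegral hN z Δ hs hf, ENNReal.ofReal_pow (abs_nonneg _), abs_sub_comm,
    ← ofReal_norm, Complex.norm_real, Real.norm_eq_abs]

end LatticeRule

/-! ### The weights `r(k)` -/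

section KorobovWeight

variable {d : ℕ} {α : ℝ} {γ : ℕ → ℝ}

theorem korobovR_neg (k : Fin d → ℤ) : korobovR α γ (-k) = korobovR α γ k := by
  simp [korobovR]

theorem korobovFactor_ge_one (hα : 0 ≤ α) {g : ℝ} (hg : g ≤ 1) {m : ℤ} (hm : m ≠ 0) :
    1 ≤ ENNReal.ofReal (|(m : ℝ)| ^ α) / ENNReal.ofReal g := by
  have h1 : (1 : ℝ) ≤ |(m : ℝ)| := by exact_mod_cast Int.one_le_abs hm
  rw [ENNReal.le_div_iff_mul_le (Or.inr (by
    simpa using (Real.rpow_pos_of_pos (one_pos.trans_le h1) α))) (Or.inr ENNReal.ofReal_ne_top),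
    one_mul]
  exact ENNReal.ofReal_le_ofReal (hg.trans (Real.one_le_rpow h1 hα))

theorem one_le_korobovR (hα : 0 ≤ α) (hγ1 : ∀ j, γ j ≤ 1) (k : Fin d → ℤ) :
    1 ≤ korobovR α γ k := by
  unfold korobovR
  refine Finset.one_le_prod' fun j _ => ?_
  split_ifs with h
  · exact le_rfl
  · exact korobovFactor_ge_one hα (hγ1 j) h

theorem ofReal_rpow_le_korobovR (hα : 0 ≤ α) (hγ1 : ∀ j, γ j ≤ 1) (k : Fin d → ℤ) (j : Fin d)
    (hj : k j ≠ 0) : ENNReal.ofReal (|(k j : ℝ)| ^ α) ≤ korobovR α γ k := by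
  unfold korobovR
  refine le_trans ?_ (Finset.single_le_prod' (fun i _ => ?_) (Finset.mem_univ j))
  · rw [if_neg hj]
    rw [ENNReal.le_div_iff_mul_le (Or.inr (by
      simpa using (Real.rpow_pos_of_pos (abs_pos.2 (Int.cast_ne_zero.2 hj)) α)))
      (Or.inr ENNReal.ofReal_ne_top)]
    exact mul_le_of_le_one_right' (ENNReal.ofReal_le_one.2 (hγ1 j))
  · split_ifs with h
    · exact le_rfl
    · exact korobovFactor_ge_one hα (hγ1 i) h

theorem tsum_le_one_of_mem_korobovBall {f : (Fin d → ℝ) → ℝ} (hf : f ∈ korobovBall α γ d) :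
    ∑' k : Fin d → ℤ, ‖cubeFourierCoeff f k‖ₑ ^ 2 * korobovR α γ k ^ 2 ≤ 1 := by
  have h := hf.2
  unfold korobovNorm at h
  have := ENNReal.rpow_le_rpow h (by norm_num : (0 : ℝ) ≤ 2)
  rwa [← ENNReal.rpow_mul, ENNReal.one_rpow, one_div_mul_cancel two_ne_zero,
    ENNReal.rpow_one] at this

end KorobovWeight

/-! ### Cosines as bad functions: lower bound for the worst-case error -/

section Cosine

variable {d : ℕ} {α : ℝ} {γ : ℕ → ℝ}

theorem neg_ne_self_of_ne_zero {k : Fin d → ℤ} (hk : k ≠ 0) : -k ≠ k := by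
  intro h
  apply hk
  ext j
  have := congrFun h j
  simp only [Pi.neg_apply] at this
  simp only [Pi.zero_apply]
  omega

/-- The cosine with frequency `h` and amplitude `2 a`. -/
noncomputable def cosineMode (a : ℝ) (h : Fin d → ℤ) (x : Fin d → ℝ) : ℝ :=
  2 * a * Real.cos (2 * Real.pi * ∑ j, (h j : ℝ) * x j)

/-- The Fourier coefficients of `cosineMode a h`. -/
noncomputable def cosineCoeff (a : ℝ) (h k : Fin d → ℤ) : ℂ :=
  if k = h ∨ k = -h then a else 0

theorem tsum_cosineCoeff {R : Type*} [AddCommMonoid R] [TopologicalSpace R] [T2Space R]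
    {a : ℝ} {h : Fin d → ℤ} (hh : h ≠ 0)
    (F : ℂ → (Fin d → ℤ) → R) (hF : ∀ k, F 0 k = 0) :
    ∑' k, F (cosineCoeff a h k) k = F a h + F a (-h) := by
  have hne := (neg_ne_self_of_ne_zero hh).symm
  rw [tsum_eq_sum (s := {h, -h}), Finset.sum_pair hne]
  · simp [cosineCoeff]
  · intro k hk
    rw [Finset.mem_insert, Finset.mem_singleton] at hk
    rw [cosineCoeff, if_neg hk, hF]

theorem summable_norm_cosineCoeff (a : ℝ) (h : Fin d → ℤ) :
    Summable fun k => ‖cosineCoeff a h k‖ := by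
  refine summable_of_ne_finset_zero (s := {h, -h}) fun k hk => ?_
  rw [Finset.mem_insert, Finset.mem_singleton] at hk
  rw [cosineCoeff, if_neg hk, norm_zero]

theorem cosineMode_eq_tsum (a : ℝ) {h : Fin d → ℤ} (hh : h ≠ 0) (x : Fin d → ℝ) :
    (cosineMode a h x : ℂ) = ∑' k, cosineCoeff a h k * fourierMode k x := by
  rw [tsum_cosineCoeff hh (fun c k => c * fourierMode k x) (by simp), ← star_fourierMode]
  have h1 : fourierMode h x =
      Complex.exp (((2 * Real.pi * ∑ j, (h j : ℝ) * x j : ℝ) : ℂ) * Complex.I) := by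
    rw [fourierMode]; congr 1; push_cast; ring
  rw [← mul_add, Complex.add_conj, h1, Complex.exp_ofReal_mul_I_re, cosineMode]
  push_cast
  ring

theorem cubeFourierCoeff_cosineMode (a : ℝ) {h : Fin d → ℤ} (hh : h ≠ 0) (k : Fin d → ℤ) :
    cubeFourierCoeff (cosineMode a h) k = cosineCoeff a h k := by
  unfold cubeFourierCoeff
  simp_rw [cosineMode_eq_tsum a hh]
  exact integral_tsum_fourierMode_mul_fourierMode_neg (summable_norm_cosineCoeff a h) k

/-- The two coefficients give squared norm `2 a² r(h)²`, which is below `(2 a r(h))²`; the lost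
factor of 2 is harmless. -/
theorem cosineMode_mem_korobovBall {h : Fin d → ℤ} (hh : h ≠ 0) {a : ℝ} (ha : 0 ≤ a)
    (haR : ENNReal.ofReal (2 * a) * korobovR α γ h ≤ 1) :
    cosineMode a h ∈ korobovBall α γ d := by
  have hnorm : korobovNorm α γ (cosineMode a h) ≤ 1 := by
    unfold korobovNorm
    refine ENNReal.rpow_le_one ?_ (by norm_num)
    simp_rw [cubeFourierCoeff_cosineMode a hh]
    rw [tsum_cosineCoeff hh (fun c k => ‖c‖ₑ ^ 2 * korobovR α γ k ^ 2) (by simp), korobovR_neg]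
    have h1 : ‖(a : ℂ)‖ₑ = ENNReal.ofReal a := by
      rw [← ofReal_norm, Complex.norm_real, Real.norm_of_nonneg ha]
    rw [h1]
    calc ENNReal.ofReal a ^ 2 * korobovR α γ h ^ 2 + ENNReal.ofReal a ^ 2 * korobovR α γ h ^ 2
        ≤ 4 * (ENNReal.ofReal a ^ 2 * korobovR α γ h ^ 2) := by
          rw [← two_mul]
          gcongr
          norm_num
      _ = (ENNReal.ofReal (2 * a) * korobovR α γ h) ^ 2 := by
          rw [ENNReal.ofReal_mul zero_le_two, ENNReal.ofReal_ofNat]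
          ring
      _ ≤ 1 := pow_le_one' haR 2
  refine ⟨⟨fun x j => ?_, ?_, fun x => ?_, hnorm.trans_lt ENNReal.one_lt_top⟩, hnorm⟩
  · have : ∑ i, (h i : ℝ) * (x + Pi.single j 1 : Fin d → ℝ) i = (∑ i, (h i : ℝ) * x i) + h j := by
      simp only [Pi.add_apply, mul_add, Finset.sum_add_distrib]
      simp [Pi.single_apply]
    rw [cosineMode, this, mul_add, mul_comm (2 * Real.pi) (h j : ℝ), Real.cos_add_int_mul_two_pi,
      cosineMode]
  · simp_rw [cubeFourierCoeff_cosineMode a hh]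
    exact summable_norm_cosineCoeff a h
  · simp_rw [cubeFourierCoeff_cosineMode a hh]
    exact cosineMode_eq_tsum a hh x

/-- A dual lattice point with a small weight forces a large worst-case error. -/
theorem inv_korobovR_le_worstCaseError (hα : 0 ≤ α) (hγ1 : ∀ j, γ j ≤ 1) {N : ℕ} (hN : N ≠ 0)
    {z : Fin d → ℕ} {h : Fin d → ℤ} (hh : h ≠ 0) (hd : InDualLattice N z h) :
    (korobovR α γ h)⁻¹ ≤ worstCaseError α γ (qmcRule (rankOneLattice N z)) := by
  by_cases htop : korobovR α γ h = ∞
  · simp [htop]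
  have h0 : korobovR α γ h ≠ 0 := (one_pos.trans_le (one_le_korobovR hα hγ1 h)).ne'
  -- The amplitude `2 a = 1 / r(h)` is admissible. Both `h` and `-h` are in the dual lattice, so the
  -- rule returns `2 a` while the integral vanishes.
  set a : ℝ := (korobovR α γ h)⁻¹.toReal / 2 with ha
  have ha0 : 0 ≤ a := by positivity
  have h2a : ENNReal.ofReal (2 * a) = (korobovR α γ h)⁻¹ := by
    rw [ha, mul_div_cancel₀ _ two_ne_zero, ENNReal.ofReal_toReal (ENNReal.inv_ne_top.2 h0)]
  have hmem : cosineMode a h ∈ korobovBall α γ d :=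
    cosineMode_mem_korobovBall hh ha0 (by rw [h2a, ENNReal.inv_mul_cancel h0 htop])
  unfold worstCaseError
  refine le_trans ?_ (le_iSup₂ (cosineMode a h) hmem)
  have hdn : InDualLattice N z (-h) := by
    unfold InDualLattice at hd ⊢
    simpa using hd
  have herr := qmcRule_sub_cubeIntegral hN z 0 hmem.1.2.1 hmem.1.2.2.1
  classical
  have hal : ∀ k, aliasedCoeff N z (cosineMode a h) k = cosineCoeff a h k := by
    intro k
    unfold aliasedCoeff
    rw [cubeFourierCoeff_cosineMode a hh, ite_eq_left_iff]
    intro hk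
    symm
    refine if_neg fun hk' => hk ?_
    rcases hk' with rfl | rfl
    · exact ⟨hh, hd⟩
    · exact ⟨neg_ne_zero.2 hh, hdn⟩
  have h0' : ∀ k : Fin d → ℤ, fourierMode k 0 = 1 := by simp [fourierMode]
  simp_rw [hal, h0', mul_one] at herr
  rw [tsum_cosineCoeff hh (fun c _ => c) (by simp), shiftPoints_rankOneLattice_zero] at herr
  have herr' : qmcRule (rankOneLattice N z) (cosineMode a h) - cubeIntegral (cosineMode a h) =
      2 * a := by
    rw [two_mul]
    exact_mod_cast herr
  rw [abs_sub_comm, herr', abs_of_nonneg (by positivity), h2a]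

end Cosine

/-! ### Upper bound for the worst-case error -/

section UpperBound

/-- The Cauchy-Schwarz inequality for infinite sums in `ℝ≥0∞`. -/
theorem ENNReal.tsum_mul_sq_le {ι : Type*} (f g : ι → ℝ≥0∞) :
    (∑' i, f i * g i) ^ 2 ≤ (∑' i, f i ^ 2) * ∑' i, g i ^ 2 := by
  have h : ∑' i, f i * g i ≤ (∑' i, f i ^ 2) ^ (1 / 2 : ℝ) * (∑' i, g i ^ 2) ^ (1 / 2 : ℝ) := by
    rw [ENNReal.tsum_eq_iSup_sum]
    refine iSup_le fun s => (ENNReal.inner_le_Lp_mul_Lq s f g Real.HolderConjugate.two_two).trans ?_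
    simp only [ENNReal.rpow_two]
    gcongr <;> exact ENNReal.sum_le_tsum s
  calc (∑' i, f i * g i) ^ 2
      ≤ ((∑' i, f i ^ 2) ^ (1 / 2 : ℝ) * (∑' i, g i ^ 2) ^ (1 / 2 : ℝ)) ^ 2 := by gcongr
    _ = _ := by
      rw [mul_pow, ← ENNReal.rpow_two, ← ENNReal.rpow_two, ← ENNReal.rpow_mul, ← ENNReal.rpow_mul]
      norm_num

/-- The `ℓ²`-norm is at most the `ℓᵖ`-norm for `p ≤ 2`. -/
theorem ENNReal.tsum_sq_le_tsum_rpow {ι : Type*} (f : ι → ℝ≥0∞) {p : ℝ} (hp : 0 < p)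
    (hp2 : p ≤ 2) : ∑' i, f i ^ 2 ≤ (∑' i, f i ^ p) ^ (2 / p) := by
  set S := ∑' i, f i ^ p with hS
  have h1 : ∀ i, f i ≤ S ^ (1 / p) := fun i => by
    rw [one_div, ENNReal.le_rpow_inv_iff hp]
    exact ENNReal.le_tsum i
  have hq : (2 - p) / p + 1 = 2 / p := by field_simp; ring
  calc ∑' i, f i ^ 2 ≤ ∑' i, f i ^ p * S ^ ((2 - p) / p) := by
        refine ENNReal.tsum_le_tsum fun i => ?_
        have h2 : f i ^ 2 = f i ^ p * f i ^ (2 - p) := by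
          rw [← ENNReal.rpow_add_of_nonneg _ _ hp.le (by linarith), ← ENNReal.rpow_two]
          congr 1; ring
        rw [h2]
        gcongr
        calc f i ^ (2 - p) ≤ (S ^ (1 / p)) ^ (2 - p) :=
              ENNReal.rpow_le_rpow (h1 i) (by linarith)
          _ = _ := by rw [← ENNReal.rpow_mul]; congr 1; ring
    _ = S ^ (2 / p) := by
        rw [ENNReal.tsum_mul_right, ← hS, mul_comm, ← hq,
          ENNReal.rpow_add_of_nonneg _ _ (by apply div_nonneg <;> linarith) zero_le_one,
          ENNReal.rpow_one]

variable {d : ℕ} {α : ℝ} {γ : ℕ → ℝ}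

open scoped Classical in
/-- The sum of the inverse weights, to the power `p`, over the nonzero dual lattice points. -/
noncomputable def dualSum (α : ℝ) (γ : ℕ → ℝ) (p : ℝ) {d : ℕ} (N : ℕ) (z : Fin d → ℕ) : ℝ≥0∞ :=
  ∑' k : Fin d → ℤ, if k ≠ 0 ∧ InDualLattice N z k then (korobovR α γ k)⁻¹ ^ p else 0

/-- The content is the case `r(k) = ∞`, where the finite norm forces the coefficient to vanish. -/
theorem enorm_le_mul_inv (hα : 0 ≤ α) (hγ1 : ∀ j, γ j ≤ 1) {f : (Fin d → ℝ) → ℝ}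
    (hf : f ∈ korobovBall α γ d) (k : Fin d → ℤ) :
    ‖cubeFourierCoeff f k‖ₑ ≤ ‖cubeFourierCoeff f k‖ₑ * korobovR α γ k * (korobovR α γ k)⁻¹ := by
  have h0 : korobovR α γ k ≠ 0 := (one_pos.trans_le (one_le_korobovR hα hγ1 k)).ne'
  by_cases htop : korobovR α γ k = ∞
  · have h1 := (ENNReal.le_tsum k).trans (tsum_le_one_of_mem_korobovBall hf)
    rw [htop] at h1
    by_cases hc : ‖cubeFourierCoeff f k‖ₑ = 0
    · simp [hc]
    · rw [ENNReal.top_pow two_ne_zero, ENNReal.mul_top (pow_ne_zero _ hc)] at h1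
      exact absurd h1 (by simp)
  · rw [mul_assoc, ENNReal.mul_inv_cancel h0 htop, mul_one]

/-- Cauchy-Schwarz against the norm leaves the `ℓ²`-norm of the inverse weights on the dual lattice,
which the `ℓᵖ`-norm dominates. With `p = 1 / lam`, the condition `p ≤ 2` is `lam ≥ 1/2`. -/
theorem worstCaseError_le_dualSum_rpow (hα : 0 ≤ α) (hγ1 : ∀ j, γ j ≤ 1) {N : ℕ} (hN : N ≠ 0)
    (z : Fin d → ℕ) {p : ℝ} (hp : 0 < p) (hp2 : p ≤ 2) :
    worstCaseError α γ (qmcRule (rankOneLattice N z)) ≤ dualSum α γ p N z ^ (1 / p) := by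
  classical
  unfold worstCaseError
  refine iSup₂_le fun f hf => ?_
  set a : (Fin d → ℤ) → ℝ≥0∞ := fun k =>
    if k ≠ 0 ∧ InDualLattice N z k then (korobovR α γ k)⁻¹ else 0 with ha
  have hda : dualSum α γ p N z = ∑' k, a k ^ p := by
    unfold dualSum
    refine tsum_congr fun k => ?_
    simp only [ha]
    split_ifs
    · rfl
    · rw [ENNReal.zero_rpow_of_pos hp]
  have herr := qmcRule_sub_cubeIntegral hN z 0 hf.1.2.1 hf.1.2.2.1
  rw [shiftPoints_rankOneLattice_zero] at herr
  have h1 : ENNReal.ofReal |cubeIntegral f - qmcRule (rankOneLattice N z) f| ≤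
      ∑' k, ‖cubeFourierCoeff f k‖ₑ * korobovR α γ k * a k := by
    rw [abs_sub_comm, ← Real.norm_eq_abs, ← Complex.norm_real, herr, ofReal_norm]
    refine enorm_tsum_le_tsum_enorm.trans (ENNReal.tsum_le_tsum fun k => ?_)
    rw [enorm_mul, ← ofReal_norm (fourierMode k 0), norm_fourierMode, ENNReal.ofReal_one, mul_one]
    unfold aliasedCoeff
    simp only [ha]
    split_ifs
    · exact enorm_le_mul_inv hα hγ1 hf k
    · simp
  have h2 : (ENNReal.ofReal |cubeIntegral f - qmcRule (rankOneLattice N z) f|) ^ 2 ≤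
      (dualSum α γ p N z ^ (1 / p)) ^ 2 := by
    calc _ ≤ (∑' k, ‖cubeFourierCoeff f k‖ₑ * korobovR α γ k * a k) ^ 2 := by gcongr
      _ ≤ (∑' k, (‖cubeFourierCoeff f k‖ₑ * korobovR α γ k) ^ 2) * ∑' k, a k ^ 2 :=
        ENNReal.tsum_mul_sq_le _ _
      _ ≤ 1 * (∑' k, a k ^ p) ^ (2 / p) := by
        gcongr
        · simp_rw [mul_pow]
          exact tsum_le_one_of_mem_korobovBall hf
        · exact ENNReal.tsum_sq_le_tsum_rpow a hp hp2
      _ = _ := by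
        rw [one_mul, hda, ← ENNReal.rpow_two, ← ENNReal.rpow_mul]
        congr 1; ring
  exact (ENNReal.pow_le_pow_left_iff two_ne_zero).1 h2

end UpperBound

/-! ### Sums of inverse weights -/

section WeightSum

/-- A sum of products over a finite power is a product of sums. -/
theorem ENNReal.tsum_fin_pi_prod {β : Type*} : ∀ (d : ℕ) (g : Fin d → β → ℝ≥0∞),
    ∑' k : Fin d → β, ∏ j, g j (k j) = ∏ j, ∑' m, g j m
  | 0, g => by simp
  | d + 1, g => by
    rw [← (Fin.consEquiv fun _ : Fin (d + 1) => β).tsum_eq, ENNReal.tsum_prod', Fin.prod_univ_succ]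
    simp only [Fin.consEquiv, Equiv.coe_fn_mk, Fin.prod_univ_succ, Fin.cons_zero, Fin.cons_succ]
    simp_rw [ENNReal.tsum_mul_left, ENNReal.tsum_fin_pi_prod d fun j => g j.succ,
      ENNReal.tsum_mul_right]

variable {d : ℕ} {α : ℝ} {γ : ℕ → ℝ}

theorem korobovR_inv_rpow (hγ0 : ∀ j, 0 ≤ γ j) {p : ℝ} (hp : 0 < p) (k : Fin d → ℤ) :
    (korobovR α γ k)⁻¹ ^ p = ∏ j, if k j = 0 then 1
      else ENNReal.ofReal (γ j ^ p) * ENNReal.ofReal (|(k j : ℝ)| ^ (-(α * p))) := by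
  have hpos : ∀ j, k j ≠ 0 → 0 < |(k j : ℝ)| := fun j hj => abs_pos.2 (Int.cast_ne_zero.2 hj)
  have hne : ∀ j : Fin d, (if k j = 0 then 1
      else ENNReal.ofReal (|(k j : ℝ)| ^ α) / ENNReal.ofReal (γ j)) ≠ 0 := by
    intro j
    split_ifs with h
    · exact one_ne_zero
    · have := Real.rpow_pos_of_pos (hpos j h) α
      exact (ENNReal.div_pos (by simpa using this) ENNReal.ofReal_ne_top).ne'
  unfold korobovR
  rw [ENNReal.prod_inv_distrib (fun i _ j _ _ => Or.inl (hne i)),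
    ← ENNReal.prod_rpow_of_nonneg hp.le]
  refine Finset.prod_congr rfl fun j _ => ?_
  split_ifs with h
  · simp
  · have h1 := Real.rpow_pos_of_pos (hpos j h) α
    rw [ENNReal.inv_div (Or.inl ENNReal.ofReal_ne_top) (Or.inr (by simpa using h1)),
      div_eq_mul_inv, ENNReal.mul_rpow_of_nonneg _ _ hp.le,
      ENNReal.ofReal_rpow_of_nonneg (hγ0 j) hp.le, ← ENNReal.ofReal_inv_of_pos h1,
      ENNReal.ofReal_rpow_of_nonneg (by positivity) hp.le, ← Real.rpow_neg (hpos j h).le,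
      ← Real.rpow_mul (hpos j h).le, neg_mul]

/-- The sum of the inverse weights to the power `p`, with a bound that depends on the dimension
only through the sum of the weights. -/
theorem exists_tsum_korobovR_inv_rpow_le (hγ0 : ∀ j, 0 ≤ γ j) {p : ℝ} (hp : 0 < p)
    (hαp : 1 < α * p) : ∃ c : ℝ, 0 ≤ c ∧ ∀ d : ℕ, ∑' k : Fin d → ℤ, (korobovR α γ k)⁻¹ ^ p ≤
      ENNReal.ofReal (Real.exp (c * ∑ j : Fin d, γ j ^ p)) := by
  have hs : Summable fun m : ℤ => |(m : ℝ)| ^ (-(α * p)) := Real.summable_abs_int_rpow hαp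
  have hnn : ∀ m : ℤ, 0 ≤ |(m : ℝ)| ^ (-(α * p)) := fun m => Real.rpow_nonneg (abs_nonneg _) _
  -- The term `m = 0` is a real power of zero with nonzero exponent, hence zero, so `c = 2 ζ(α p)`.
  set c := ∑' m : ℤ, |(m : ℝ)| ^ (-(α * p)) with hc
  have hc0 : 0 ≤ c := tsum_nonneg hnn
  refine ⟨c, hc0, fun d => ?_⟩
  simp_rw [korobovR_inv_rpow hγ0 hp]
  rw [ENNReal.tsum_fin_pi_prod d fun j (m : ℤ) => if m = 0 then 1
      else ENNReal.ofReal (γ j ^ p) * ENNReal.ofReal (|(m : ℝ)| ^ (-(α * p)))]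
  rw [Finset.mul_sum, Real.exp_sum, ENNReal.ofReal_prod_of_nonneg fun j _ => (Real.exp_pos _).le]
  refine Finset.prod_le_prod' fun j _ => ?_
  have hg : 0 ≤ γ j ^ p := Real.rpow_nonneg (hγ0 j) _
  calc (∑' m : ℤ, if m = 0 then 1
        else ENNReal.ofReal (γ j ^ p) * ENNReal.ofReal (|(m : ℝ)| ^ (-(α * p))))
      ≤ ∑' m : ℤ, ((if m = 0 then 1 else 0) +
        ENNReal.ofReal (γ j ^ p) * ENNReal.ofReal (|(m : ℝ)| ^ (-(α * p)))) := by
        refine ENNReal.tsum_le_tsum fun m => ?_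
        split_ifs <;> simp
    _ = ENNReal.ofReal (c * γ j ^ p + 1) := by
        rw [ENNReal.tsum_add, tsum_ite_eq, ENNReal.tsum_mul_left,
          ← ENNReal.ofReal_tsum_of_nonneg hnn hs, ← ENNReal.ofReal_mul hg, add_comm,
          ENNReal.ofReal_add (by positivity) zero_le_one, ENNReal.ofReal_one, mul_comm]
    -- Passing from `1 + x` to `exp x` turns the product over coordinates into the exponential of a
    -- sum of weights.
    _ ≤ _ := ENNReal.ofReal_le_ofReal (Real.add_one_le_exp _)

/-- Every nonzero coordinate gains a factor `N ^ α ≥ 1`, and there is at least one. -/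
theorem mul_korobovR_le_korobovR_smul (hα : 0 ≤ α) {N : ℕ} (hN : N ≠ 0) {k : Fin d → ℤ}
    (hk : k ≠ 0) :
    ENNReal.ofReal ((N : ℝ) ^ α) * korobovR α γ k ≤ korobovR α γ ((N : ℤ) • k) := by
  obtain ⟨j₀, hj₀⟩ := Function.ne_iff.1 hk
  have hN1 : (1 : ℝ) ≤ N := by exact_mod_cast Nat.one_le_iff_ne_zero.2 hN
  have h1 : korobovR α γ ((N : ℤ) • k) =
      (∏ j, if k j = 0 then 1 else ENNReal.ofReal ((N : ℝ) ^ α)) * korobovR α γ k := by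
    unfold korobovR
    rw [← Finset.prod_mul_distrib]
    refine Finset.prod_congr rfl fun j _ => ?_
    by_cases h : k j = 0
    · simp [h]
    · have : (N : ℤ) * k j ≠ 0 := mul_ne_zero (Int.natCast_ne_zero.2 hN) h
      simp only [Pi.smul_apply, smul_eq_mul, this, h, if_false]
      rw [Int.cast_mul, abs_mul, Int.cast_natCast, Nat.abs_cast,
        Real.mul_rpow (Nat.cast_nonneg _) (abs_nonneg _),
        ENNReal.ofReal_mul (by positivity), mul_div_assoc]
  rw [h1]
  gcongr
  refine le_trans (le_of_eq ?_) (Finset.single_le_prod' (f := fun j => if k j = 0 then (1 : ℝ≥0∞)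
    else ENNReal.ofReal ((N : ℝ) ^ α)) (fun i _ => ?_) (Finset.mem_univ j₀))
  · exact (if_neg hj₀).symm
  · split_ifs
    · exact le_rfl
    · exact ENNReal.one_le_ofReal.2 (Real.one_le_rpow hN1 hα)

theorem korobovR_smul_inv_rpow_le (hα : 0 ≤ α) {p : ℝ} (hp : 0 < p) (hαp : 1 ≤ α * p)
    {N : ℕ} (hN : N ≠ 0) {k : Fin d → ℤ} (hk : k ≠ 0) :
    (korobovR α γ ((N : ℤ) • k))⁻¹ ^ p ≤ (N : ℝ≥0∞)⁻¹ * (korobovR α γ k)⁻¹ ^ p := by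
  have hN1 : (1 : ℝ) ≤ N := by exact_mod_cast Nat.one_le_iff_ne_zero.2 hN
  have hNp : 0 < (N : ℝ) ^ α := by positivity
  have h0 : ENNReal.ofReal ((N : ℝ) ^ α) ≠ 0 := by simpa using hNp
  calc (korobovR α γ ((N : ℤ) • k))⁻¹ ^ p
      ≤ (ENNReal.ofReal ((N : ℝ) ^ α) * korobovR α γ k)⁻¹ ^ p := by
        gcongr
        exact mul_korobovR_le_korobovR_smul hα hN hk
    _ = (ENNReal.ofReal ((N : ℝ) ^ α))⁻¹ ^ p * (korobovR α γ k)⁻¹ ^ p := by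
        rw [ENNReal.mul_inv (Or.inl h0) (Or.inl ENNReal.ofReal_ne_top),
          ENNReal.mul_rpow_of_nonneg _ _ hp.le]
    _ ≤ _ := by
        gcongr
        rw [ENNReal.inv_rpow, ENNReal.inv_le_inv, ENNReal.ofReal_rpow_of_nonneg hNp.le hp.le,
          ← Real.rpow_mul (by positivity), ← ENNReal.ofReal_natCast]
        exact ENNReal.ofReal_le_ofReal (Real.self_le_rpow_of_one_le hN1 hαp)

open scoped Classical in
/-- The inverse weights at the nonzero multiples of `N` contribute little. -/
theorem tsum_korobovR_inv_rpow_multiples_le (hα : 0 ≤ α) {p : ℝ} (hp : 0 < p) (hαp : 1 ≤ α * p)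
    {N : ℕ} (hN : N ≠ 0) :
    (∑' k : Fin d → ℤ, if k ≠ 0 ∧ ∀ j, (N : ℤ) ∣ k j then (korobovR α γ k)⁻¹ ^ p else 0) ≤
      (N : ℝ≥0∞)⁻¹ * ∑' k : Fin d → ℤ, (korobovR α γ k)⁻¹ ^ p := by
  have hN' : (N : ℤ) ≠ 0 := Int.natCast_ne_zero.2 hN
  have hinj : Function.Injective fun k : Fin d → ℤ => (N : ℤ) • k := by
    intro k l h
    ext j
    have := congrFun h j
    simpa [hN] using this
  rw [← hinj.tsum_eq]
  · rw [← ENNReal.tsum_mul_left]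
    refine ENNReal.tsum_le_tsum fun k => ?_
    split_ifs with h
    · refine korobovR_smul_inv_rpow_le hα hp hαp hN fun hk => h.1 ?_
      rw [hk, smul_zero]
    · exact zero_le
  · intro k hk
    rw [Function.mem_support] at hk
    have h : ∀ j, (N : ℤ) ∣ k j := by
      by_contra hcon
      exact hk (if_neg fun h => hcon h.2)
    choose l hl using h
    exact ⟨l, by ext j; simp [hl j]⟩

end WeightSum

/-! ### Uniform distributions on finite sets -/

section UniformOn

variable {Ω : Type*} [MeasurableSpace Ω] [MeasurableSingletonClass Ω]

theorem lintegral_uniformOn_finset (s : Finset Ω) (g : Ω → ℝ≥0∞) :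
    ∫⁻ x, g x ∂uniformOn (s : Set Ω) = (∑ x ∈ s, g x) / s.card := by
  rw [uniformOn, ProbabilityTheory.cond, lintegral_smul_measure, lintegral_finset,
    Measure.count_apply_finset, smul_eq_mul, mul_comm, div_eq_mul_inv]
  simp

theorem uniformOn_finset_apply (s : Finset Ω) (t : Set Ω) [DecidablePred (· ∈ t)] :
    uniformOn (s : Set Ω) t = (s.filter (· ∈ t)).card / s.card := by
  classical
  have : (s : Set Ω) ∩ t = ((s.filter (· ∈ t) : Finset Ω) : Set Ω) := by
    ext; simp
  rw [← uniformOn_inter_self s.finite_toSet, this, uniformOn_apply_finset]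
  congr 3
  ext x
  simp

end UniformOn

/-! ### Random generating vectors -/

section GeneratingVectors

variable {d : ℕ}

/-- The set `{1, …, N-1}^d` as a finite set. -/
def genFinset (d N : ℕ) : Finset (Fin d → ℕ) :=
  Fintype.piFinset fun _ => Finset.Icc 1 (N - 1)

theorem mem_genFinset {N : ℕ} {z : Fin d → ℕ} : z ∈ genFinset d N ↔ ∀ j, 1 ≤ z j ∧ z j ≤ N - 1 := by
  simp [genFinset]

theorem coe_genFinset (d N : ℕ) : (genFinset d N : Set (Fin d → ℕ)) = genVectors d N := by
  ext z
  rw [Finset.mem_coe, mem_genFinset]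
  rfl

theorem genFinset_nonempty {N : ℕ} (hN : 2 ≤ N) : (genFinset d N).Nonempty :=
  ⟨fun _ => 1, mem_genFinset.2 fun _ => ⟨le_rfl, by omega⟩⟩

theorem isProbabilityMeasure_uniformOn_genVectors {N : ℕ} (hN : 2 ≤ N) :
    IsProbabilityMeasure (uniformOn (genVectors d N)) := by
  rw [← coe_genFinset]
  exact isProbabilityMeasure_uniformOn (Finset.finite_toSet _) (genFinset_nonempty hN)

open scoped Classical in
-- As `k j₀` is invertible modulo the prime `N`, the other components of a solution `z` determine `z
-- j₀`. Hence overwriting `z j₀` by any of the `N - 1` values is injective on pairs of solution and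
-- value.
theorem card_filter_inDualLattice_mul_le {N : ℕ} (hN : N.Prime) {k : Fin d → ℤ} {j₀ : Fin d}
    (hj : ¬ (N : ℤ) ∣ k j₀) :
    ((genFinset d N).filter fun z => InDualLattice N z k).card * (N - 1) ≤
      (genFinset d N).card := by
  have hcard : (Finset.Icc 1 (N - 1)).card = N - 1 := by simp
  conv_lhs => rw [← hcard]
  rw [← Finset.card_product]
  refine Finset.card_le_card_of_injOn (fun q => Function.update q.1 j₀ q.2) ?_ ?_
  · intro q hq
    simp only [Finset.coe_product, Set.mem_prod, Finset.mem_coe, Finset.mem_filter,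
      Finset.mem_Icc, mem_genFinset] at hq ⊢
    intro j
    by_cases h : j = j₀
    · subst h; simpa using hq.2
    · simpa [h] using hq.1.1 j
  · rintro ⟨z, a⟩ hz ⟨z', a'⟩ hz' heq
    simp only [Finset.coe_product, Set.mem_prod, Finset.mem_coe, Finset.mem_filter,
      Finset.mem_Icc, mem_genFinset] at hz hz'
    have ha : a = a' := by simpa using congrFun heq j₀
    have hoff : ∀ j, j ≠ j₀ → z j = z' j := fun j h => by simpa [h] using congrFun heq j
    have hsum : ∑ j, k j * (z j : ℤ) - ∑ j, k j * (z' j : ℤ) =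
        k j₀ * ((z j₀ : ℤ) - z' j₀) := by
      rw [← Finset.sum_sub_distrib, Finset.sum_eq_single j₀]
      · ring
      · intro j _ h
        rw [hoff j h, sub_self]
      · simp
    have hdvd : (N : ℤ) ∣ k j₀ * ((z j₀ : ℤ) - z' j₀) := hsum ▸ dvd_sub hz.1.2 hz'.1.2
    have hdvd' := ((Nat.prime_iff_prime_int.1 hN).dvd_or_dvd hdvd).resolve_left hj
    have hz0 : z j₀ = z' j₀ := by
      have h1 := hz.1.1 j₀
      have h2 := hz'.1.1 j₀
      have := Int.eq_zero_of_abs_lt_dvd hdvd' (by rw [abs_lt]; omega)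
      omega
    have hzz : z = z' := by
      ext j
      by_cases h : j = j₀
      · rw [h, hz0]
      · exact hoff j h
    rw [hzz, ha]

theorem uniformOn_inDualLattice_le {N : ℕ} (hN : N.Prime) {k : Fin d → ℤ} {j₀ : Fin d}
    (hj : ¬ (N : ℤ) ∣ k j₀) :
    uniformOn (genVectors d N) {z | InDualLattice N z k} ≤ 2 * (N : ℝ≥0∞)⁻¹ := by
  classical
  have h2 := hN.two_le
  rw [← coe_genFinset, uniformOn_finset_apply]
  have h := card_filter_inDualLattice_mul_le hN hj
  have hpos : 0 < (genFinset d N).card := Finset.card_pos.2 (genFinset_nonempty h2)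
  have hle : ((genFinset d N).filter fun z => InDualLattice N z k).card * N ≤
      2 * (genFinset d N).card := by
    calc _ ≤ ((genFinset d N).filter fun z => InDualLattice N z k).card * (2 * (N - 1)) := by
          gcongr; omega
      _ = 2 * (((genFinset d N).filter fun z => InDualLattice N z k).card * (N - 1)) := by ring
      _ ≤ _ := by gcongr
  refine ENNReal.div_le_of_le_mul ?_
  rw [mul_assoc, mul_comm _ ((genFinset d N).card : ℝ≥0∞), ← mul_assoc, ← div_eq_mul_inv,
    ENNReal.le_div_iff_mul_le (Or.inl (by simp [hN.ne_zero])) (Or.inl (by simp))]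
  exact_mod_cast hle

variable {α : ℝ} {γ : ℕ → ℝ}

/-- The mean of `dualSum` over all generating vectors. -/
theorem lintegral_dualSum_le (hα : 0 ≤ α) {p : ℝ} (hp : 0 < p) (hαp : 1 ≤ α * p)
    {N : ℕ} (hN : N.Prime) :
    ∫⁻ z, dualSum α γ p N z ∂uniformOn (genVectors d N) ≤
      3 * (N : ℝ≥0∞)⁻¹ * ∑' k : Fin d → ℤ, (korobovR α γ k)⁻¹ ^ p := by
  classical
  have := isProbabilityMeasure_uniformOn_genVectors (d := d) hN.two_le
  unfold dualSum
  rw [lintegral_tsum fun k => Measurable.of_discrete.aemeasurable]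
  calc _ ≤ ∑' k : Fin d → ℤ, (2 * (N : ℝ≥0∞)⁻¹ * (korobovR α γ k)⁻¹ ^ p +
        if k ≠ 0 ∧ ∀ j, (N : ℤ) ∣ k j then (korobovR α γ k)⁻¹ ^ p else 0) := by
        refine ENNReal.tsum_le_tsum fun k => ?_
        by_cases hk : k = 0
        · simp [hk]
        have h1 : ∫⁻ z, (if k ≠ 0 ∧ InDualLattice N z k then (korobovR α γ k)⁻¹ ^ p else 0)
            ∂uniformOn (genVectors d N) = (korobovR α γ k)⁻¹ ^ p *
              uniformOn (genVectors d N) {z | InDualLattice N z k} := by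
          rw [← lintegral_indicator_const (MeasurableSet.of_discrete)]
          refine lintegral_congr fun z => ?_
          simp [Set.indicator_apply, hk]
        rw [h1]
        -- Multiples of `N` lie in every dual lattice, but their weights save a factor `1 / N`; all
        -- other frequencies have probability at most `2 / N`. Together this gives the constant 3.
        by_cases hd : ∀ j, (N : ℤ) ∣ k j
        · rw [if_pos ⟨hk, hd⟩]
          exact le_add_left (mul_le_of_le_one_right' prob_le_one)
        · rw [if_neg fun h => hd h.2, add_zero, mul_comm]
          push Not at hd
          obtain ⟨j, hj⟩ := hd
          gcongr
          exact uniformOn_inDualLattice_le hN hj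
    _ ≤ 2 * (N : ℝ≥0∞)⁻¹ * (∑' k : Fin d → ℤ, (korobovR α γ k)⁻¹ ^ p) +
        (N : ℝ≥0∞)⁻¹ * ∑' k : Fin d → ℤ, (korobovR α γ k)⁻¹ ^ p := by
        rw [ENNReal.tsum_add, ENNReal.tsum_mul_left]
        gcongr
        exact tsum_korobovR_inv_rpow_multiples_le hα hp hαp hN.ne_zero
    _ = _ := by ring

/-- Most generating vectors have a small worst-case error. -/
theorem uniformOn_lt_worstCaseError_le (hα : 0 ≤ α) (hγ1 : ∀ j, γ j ≤ 1) {p : ℝ} (hp : 0 < p)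
    (hp2 : p ≤ 2) (hαp : 1 ≤ α * p) {N : ℕ} (hN : N.Prime) {b : ℝ≥0∞} (hb0 : b ≠ 0)
    (hb : b ≠ ∞) :
    uniformOn (genVectors d N) {z | b < worstCaseError α γ (qmcRule (rankOneLattice N z))} ≤
      (3 * (N : ℝ≥0∞)⁻¹ * ∑' k : Fin d → ℤ, (korobovR α γ k)⁻¹ ^ p) / b ^ p := by
  -- Markov's inequality for `dualSum`, which dominates the `p`-th power of the worst-case error.
  refine le_trans (measure_mono (t := {z | b ^ p ≤ dualSum α γ p N z}) fun z hz => ?_)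
    ((meas_ge_le_lintegral_div Measurable.of_discrete.aemeasurable ?_ ?_).trans ?_)
  · have h1 : b < worstCaseError α γ (qmcRule (rankOneLattice N z)) := hz
    have h2 := h1.le.trans (worstCaseError_le_dualSum_rpow hα hγ1 hN.ne_zero z hp hp2)
    rwa [one_div, ENNReal.le_rpow_inv_iff hp] at h2
  · exact fun h => hb0 ((ENNReal.rpow_eq_zero_iff_of_pos hp).1 h)
  · exact ENNReal.rpow_ne_top_of_nonneg hp.le hb
  · exact ENNReal.div_le_div_right (lintegral_dualSum_le hα hp hαp hN) _

end GeneratingVectors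

/-! ### The random draw and the dual lattice probabilities -/

section Draw

variable {d r : ℕ} {α : ℝ} {γ : ℕ → ℝ}

/-- The law of `r` independent uniformly distributed generating vectors. -/
noncomputable def trialLaw (d r N : ℕ) : Measure (Fin r → Fin d → ℕ) :=
  Measure.pi fun _ : Fin r => uniformOn (genVectors d N)

theorem isProbabilityMeasure_trialLaw {N : ℕ} (hN : 2 ≤ N) :
    IsProbabilityMeasure (trialLaw d r N) := by
  have := isProbabilityMeasure_uniformOn_genVectors (d := d) hN
  unfold trialLaw
  infer_instance

/-- An inequality is enough for upper bounds, and it requires no measurability of `F`. -/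
theorem lintegral_drawLaw_le (M : ℕ) (F : ℕ × (Fin r → Fin d → ℕ) → ℝ≥0∞) :
    ∫⁻ ω, F ω ∂drawLaw d r M ≤
      (∑ N ∈ upperPrimes M, ∫⁻ Z, F (N, Z) ∂trialLaw d r N) / (upperPrimes M).card := by
  unfold drawLaw
  refine (Measure.lintegral_bind_le _ _ _).trans ?_
  rw [← coe_upperPrimes, lintegral_uniformOn_finset]
  gcongr with N hN
  exact (lintegral_prod_le _).trans_eq (lintegral_dirac _ _)

/-- A union bound for the probability that the selected lattice has `k` in its dual. -/
theorem trialLaw_selected_inDualLattice_le {N : ℕ} (hN : N.Prime) {k : Fin d → ℤ} {j₀ : Fin d}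
    (hj : ¬ (N : ℤ) ∣ k j₀) (s : (Fin r → Fin d → ℕ) → Fin r) :
    trialLaw d r N {Z | InDualLattice N (Z (s Z)) k} ≤ r * (2 * (N : ℝ≥0∞)⁻¹) := by
  have := isProbabilityMeasure_uniformOn_genVectors (d := d) hN.two_le
  calc trialLaw d r N {Z | InDualLattice N (Z (s Z)) k}
      ≤ trialLaw d r N (⋃ i, Function.eval i ⁻¹' {z | InDualLattice N z k}) := by
        refine measure_mono fun Z hZ => Set.mem_iUnion.2 ⟨s Z, hZ⟩
    _ ≤ ∑ i : Fin r, trialLaw d r N (Function.eval i ⁻¹' {z | InDualLattice N z k}) :=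
        measure_iUnion_fintype_le _ _
    _ ≤ ∑ _i : Fin r, 2 * (N : ℝ≥0∞)⁻¹ := by
        refine Finset.sum_le_sum fun i _ => ?_
        rw [trialLaw, (measurePreserving_eval (fun _ : Fin r => uniformOn (genVectors d N))
          i).measure_preimage MeasurableSet.of_discrete.nullMeasurableSet]
        exact uniformOn_inDualLattice_le hN hj
    _ = _ := by simp

theorem ae_trialLaw_mem_genVectors {N : ℕ} (hN : 2 ≤ N) :
    ∀ᵐ Z ∂trialLaw d r N, ∀ i, Z i ∈ genVectors d N := by
  have := isProbabilityMeasure_uniformOn_genVectors (d := d) hN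
  have h : ∀ᵐ z ∂uniformOn (genVectors d N), z ∈ genVectors d N :=
     ae_cond_mem MeasurableSet.of_discrete
  exact Filter.eventually_all.2 fun i =>
    (Measure.tendsto_eval_ae_ae (μ := fun _ : Fin r => uniformOn (genVectors d N))).eventually h

/-- A dual lattice point of small weight can only occur if all the trials failed. -/
theorem trialLaw_selected_inDualLattice_le_pow (hα : 0 ≤ α) (hγ1 : ∀ j, γ j ≤ 1) {M N : ℕ}
    (hN : N ∈ primeRange M) {sel : ℕ → (Fin r → Fin d → ℕ) → Fin r}
    (hsel : IsArgminSelection α γ d r M sel) {k : Fin d → ℤ} (hk : k ≠ 0) {b : ℝ≥0∞}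
    (hb : b < (korobovR α γ k)⁻¹) :
    trialLaw d r N {Z | InDualLattice N (Z (sel N Z)) k} ≤
      uniformOn (genVectors d N)
        {z | b < worstCaseError α γ (qmcRule (rankOneLattice N z))} ^ r := by
  have := isProbabilityMeasure_uniformOn_genVectors (d := d) hN.1.two_le
  calc trialLaw d r N {Z | InDualLattice N (Z (sel N Z)) k}
      ≤ trialLaw d r N (Set.univ.pi fun _ : Fin r =>
          {z | b < worstCaseError α γ (qmcRule (rankOneLattice N z))}) := by
        refine measure_mono_ae ?_
        -- Minimality of the selected vector is guaranteed only on admissible draws, which have full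
        -- measure; it passes the large error on to every trial, and independence then gives the
        -- power `r`.
        filter_upwards [ae_trialLaw_mem_genVectors hN.1.two_le] with Z hZ hd i _
        exact hb.trans_le ((inv_korobovR_le_worstCaseError hα hγ1 hN.1.ne_zero hk hd).trans
          (hsel N hN Z hZ i))
    _ = _ := by
        rw [trialLaw, Measure.pi_pi]
        simp

/-- The probability that `k` is in the dual of the selected lattice. -/
noncomputable def dualProb (d r M : ℕ) (sel : ℕ → (Fin r → Fin d → ℕ) → Fin r)
    (k : Fin d → ℤ) : ℝ≥0∞ :=
  (∑ N ∈ upperPrimes M, trialLaw d r N {Z | InDualLattice N (Z (sel N Z)) k}) /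
    (upperPrimes M).card

theorem lintegral_aliasedCoeff_sq (N : ℕ) (s : (Fin r → Fin d → ℕ) → Fin r)
    (f : (Fin d → ℝ) → ℝ) :
    ∫⁻ Z, ∑' k, ‖aliasedCoeff N (Z (s Z)) f k‖ₑ ^ 2 ∂trialLaw d r N =
      ∑' k, if k = 0 then 0 else ‖cubeFourierCoeff f k‖ₑ ^ 2 *
        trialLaw d r N {Z | InDualLattice N (Z (s Z)) k} := by
  rw [lintegral_tsum fun k => Measurable.of_discrete.aemeasurable]
  refine tsum_congr fun k => ?_
  split_ifs with hk
  · simp [aliasedCoeff, hk]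
  · rw [← lintegral_indicator_const (MeasurableSet.of_discrete)]
    refine lintegral_congr fun Z => ?_
    by_cases hd : InDualLattice N (Z (s Z)) k <;>
      simp [hk, hd, aliasedCoeff]

/-- The mean squared error of the randomized rule in terms of the dual lattice probabilities. -/
theorem lintegral_sq_error_le {M : ℕ} (sel : ℕ → (Fin r → Fin d → ℕ) → Fin r)
    {f : (Fin d → ℝ) → ℝ} (hf : f ∈ korobovSpace α γ d) :
    ∫⁻ ω, ENNReal.ofReal (|cubeIntegral f - qmcRule (shiftPoints
        (rankOneLattice ω.1.1 (ω.1.2 (sel ω.1.1 ω.1.2))) ω.2) f| ^ 2) ∂((drawLaw d r M).prod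
          (volume.restrict (Set.Icc (0 : Fin d → ℝ) 1))) ≤
      ∑' k, if k = 0 then 0 else ‖cubeFourierCoeff f k‖ₑ ^ 2 * dualProb d r M sel k := by
  refine (lintegral_prod_le _).trans ((lintegral_drawLaw_le _ _).trans ?_)
  have h : ∀ N ∈ upperPrimes M, ∫⁻ Z, (∫⁻ Δ in Set.Icc (0 : Fin d → ℝ) 1,
      ENNReal.ofReal (|cubeIntegral f - qmcRule (shiftPoints
        (rankOneLattice N (Z (sel N Z))) Δ) f| ^ 2)) ∂trialLaw d r N =
      ∑' k, if k = 0 then 0 else ‖cubeFourierCoeff f k‖ₑ ^ 2 *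
        trialLaw d r N {Z | InDualLattice N (Z (sel N Z)) k} := by
    intro N hN
    have hN0 : N ≠ 0 := (mem_upperPrimes.1 hN).1.ne_zero
    simp_rw [lintegral_shift_sq_error hN0 _ hf.2.1 hf.2.2.1]
    exact lintegral_aliasedCoeff_sq N (sel N) f
  dsimp only
  rw [Finset.sum_congr rfl h, ← Summable.tsum_finsetSum fun _ _ => ENNReal.summable,
    div_eq_mul_inv, ← ENNReal.tsum_mul_right]
  refine ENNReal.tsum_le_tsum fun k => ?_
  split_ifs with hk
  · simp
  · rw [dualProb, div_eq_mul_inv, ← Finset.mul_sum, mul_assoc]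

/-- The numbers `|f̂(k)|² r(k)²` have sum at most 1, so the mean squared error is bounded by the
supremum of `dualProb / r(k)²` over `k ≠ 0`. -/
theorem shiftedLatticeRMSE_le {M : ℕ} (sel : ℕ → (Fin r → Fin d → ℕ) → Fin r) {c : ℝ≥0∞}
    (hc : ∀ k : Fin d → ℤ, k ≠ 0 → dualProb d r M sel k ≤ c ^ 2 * korobovR α γ k ^ 2) :
    shiftedLatticeRMSE α γ d r M sel ≤ c := by
  unfold shiftedLatticeRMSE worstCaseRMSE
  refine iSup₂_le fun f hf => ?_
  rw [one_div, ENNReal.rpow_inv_le_iff two_pos, ENNReal.rpow_two]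
  refine (lintegral_sq_error_le sel hf.1).trans ?_
  calc _ ≤ ∑' k : Fin d → ℤ, c ^ 2 * (‖cubeFourierCoeff f k‖ₑ ^ 2 * korobovR α γ k ^ 2) := by
        refine ENNReal.tsum_le_tsum fun k => ?_
        split_ifs with hk
        · exact zero_le
        · rw [mul_left_comm]
          gcongr
          exact hc k hk
    _ ≤ c ^ 2 * 1 := by
        rw [ENNReal.tsum_mul_left]
        gcongr
        exact tsum_le_one_of_mem_korobovBall hf
    _ = _ := mul_one _

theorem dualProb_le_of_forall_le {M : ℕ} (hM : 2 ≤ M) {sel : ℕ → (Fin r → Fin d → ℕ) → Fin r}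
    {k : Fin d → ℤ} {x : ℝ≥0∞}
    (h : ∀ N ∈ upperPrimes M, trialLaw d r N {Z | InDualLattice N (Z (sel N Z)) k} ≤ x) :
    dualProb d r M sel k ≤ x := by
  have hP : (upperPrimes M).card ≠ 0 := (Finset.card_pos.2 (upperPrimes_nonempty hM)).ne'
  unfold dualProb
  refine ENNReal.div_le_of_le_mul ((Finset.sum_le_card_nsmul _ _ _ h).trans_eq ?_)
  rw [nsmul_eq_mul, mul_comm]

/-- The probability of a dual lattice point, split according to whether it is a multiple of `N`. -/
theorem dualProb_le {M : ℕ} (hM : 2 ≤ M) (sel : ℕ → (Fin r → Fin d → ℕ) → Fin r)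
    (k : Fin d → ℤ) (j₀ : Fin d) :
    dualProb d r M sel k ≤ ENNReal.ofReal
      ((((upperPrimes M).filter fun p : ℕ => (p : ℤ) ∣ k j₀).card : ℝ) / (upperPrimes M).card +
        4 * r / M) := by
  classical
  have hP : 0 < (upperPrimes M).card := Finset.card_pos.2 (upperPrimes_nonempty hM)
  have hPr : (0 : ℝ) < (upperPrimes M).card := by exact_mod_cast hP
  have hMr : (0 : ℝ) < M := by exact_mod_cast (by omega : 0 < M)
  -- Primes dividing `k j₀` get the trivial bound 1; for the others the union bound `2 r / N` is at
  -- most `4 r / M`, since `M < 2 N`.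
  have hN : ∀ N ∈ upperPrimes M, trialLaw d r N {Z | InDualLattice N (Z (sel N Z)) k} ≤
      (if (N : ℤ) ∣ k j₀ then 1 else 0) + ENNReal.ofReal (4 * r / M) := by
    intro N hN
    have hp := (mem_upperPrimes.1 hN).1
    have := isProbabilityMeasure_trialLaw (d := d) (r := r) hp.two_le
    split_ifs with h
    · exact le_add_right prob_le_one
    · rw [zero_add]
      refine (trialLaw_selected_inDualLattice_le hp h (sel N)).trans ?_
      have hNr : (0 : ℝ) < N := by exact_mod_cast hp.pos
      have h1 : (r : ℝ≥0∞) * (2 * (N : ℝ≥0∞)⁻¹) = ENNReal.ofReal (r * (2 * (N : ℝ)⁻¹)) := by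
        rw [ENNReal.ofReal_mul (by positivity), ENNReal.ofReal_mul (by positivity),
          ENNReal.ofReal_inv_of_pos hNr]
        simp
      rw [h1]
      refine ENNReal.ofReal_le_ofReal ?_
      have h2 : (M : ℝ) ≤ 2 * N := by exact_mod_cast (two_mul_gt_of_mem_upperPrimes hN).le
      have h3 : 2 * (N : ℝ)⁻¹ ≤ 4 / M := by
        rw [← div_eq_mul_inv, div_le_div_iff₀ hNr hMr]
        linarith
      calc (r : ℝ) * (2 * (N : ℝ)⁻¹) ≤ r * (4 / M) := by gcongr
        _ = _ := by ring
  unfold dualProb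
  refine ENNReal.div_le_of_le_mul ((Finset.sum_le_sum hN).trans_eq ?_)
  rw [Finset.sum_add_distrib, Finset.sum_boole, Finset.sum_const, nsmul_eq_mul,
    ENNReal.ofReal_add (by positivity) (by positivity), add_mul,
    mul_comm _ (ENNReal.ofReal (4 * _ / _))]
  congr 1
  rw [← ENNReal.ofReal_natCast, ← ENNReal.ofReal_natCast (upperPrimes M).card,
    ← ENNReal.ofReal_mul (by positivity), div_mul_cancel₀ _ hPr.ne']

end Draw

/-! ### The number of trials -/

section NumberOfTrials

variable {α η : ℝ}

/-- This dictates the choice of `r`: the square root of the right-hand side is `M ^ (-α - 1/2)`. -/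
theorem pow_numTrials_le (hη : η ∈ Set.Ioo (0 : ℝ) 1) {M : ℕ} (hM : 2 ≤ M) :
    (1 - η) ^ numTrials α η M ≤ (M : ℝ) ^ (-(2 * α + 1)) := by
  have h0 : 0 < 1 - η := by linarith [hη.2]
  have hM0 : (0 : ℝ) < M := by exact_mod_cast (by omega : 0 < M)
  have hlog : Real.log (1 - η) < 0 := Real.log_neg h0 (by linarith [hη.1])
  have hr : -(2 * α + 1) * (Real.log M / Real.log (1 - η)) ≤ numTrials α η M := Nat.le_ceil _
  rw [← Real.rpow_natCast, Real.rpow_def_of_pos h0, Real.rpow_def_of_pos hM0, Real.exp_le_exp]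
  have := mul_le_mul_of_nonpos_left hr hlog.le
  calc Real.log (1 - η) * (numTrials α η M : ℝ)
      ≤ Real.log (1 - η) * (-(2 * α + 1) * (Real.log M / Real.log (1 - η))) := this
    _ = _ := by field_simp [hlog.ne]

/-- Rounding up costs at most 1, and `1 ≤ log M / log 2`. -/
theorem numTrials_le (hα : 0 ≤ α) (hη : η ∈ Set.Ioo (0 : ℝ) 1) {M : ℕ} (hM : 2 ≤ M) :
    (numTrials α η M : ℝ) ≤
      ((2 * α + 1) / (-Real.log (1 - η)) + 1 / Real.log 2) * Real.log M := by
  have h0 : 0 < 1 - η := by linarith [hη.2]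
  have hlog : Real.log (1 - η) < 0 := Real.log_neg h0 (by linarith [hη.1])
  have hl2 : 0 < Real.log 2 := Real.log_pos one_lt_two
  have hlM : Real.log 2 ≤ Real.log M := Real.log_le_log two_pos (by exact_mod_cast hM)
  have heq : -(2 * α + 1) * (Real.log M / Real.log (1 - η)) =
      (2 * α + 1) / (-Real.log (1 - η)) * Real.log M := by
    rw [div_neg]; ring
  have hnn : 0 ≤ -(2 * α + 1) * (Real.log M / Real.log (1 - η)) := by
    rw [heq]
    exact mul_nonneg (div_nonneg (by linarith) (by linarith)) (by linarith)
  have h1 := (Nat.ceil_lt_add_one hnn).le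
  have h2 : 1 ≤ 1 / Real.log 2 * Real.log M := by
    rw [div_mul_eq_mul_div, one_mul, le_div_iff₀ hl2]; linarith
  unfold numTrials
  rw [add_mul, ← heq]
  linarith

end NumberOfTrials

/-! ### Combining the two ranges of frequencies -/

section Rate

variable {d : ℕ} {α η : ℝ} {γ : ℕ → ℝ}

/-- With the threshold `(6 A / (1 - η) / M) ^ lam` a trial fails with probability at most
`1 - η`. -/
theorem uniformOn_threshold_lt_worstCaseError_le (hγ1 : ∀ j, γ j ≤ 1)
    (hη : η ∈ Set.Ioo (0 : ℝ) 1) {lam : ℝ} (hlam : lam ∈ Set.Ico (1 / 2) α) {A : ℝ} (hA : 1 ≤ A)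
    (hS : ∑' k : Fin d → ℤ, (korobovR α γ k)⁻¹ ^ (1 / lam) ≤ ENNReal.ofReal A) {M N : ℕ}
    (hM : 2 ≤ M) (hN : N ∈ upperPrimes M) :
    uniformOn (genVectors d N) {z | ENNReal.ofReal ((6 * A / (1 - η) / M) ^ lam) <
        worstCaseError α γ (qmcRule (rankOneLattice N z))} ≤ ENNReal.ofReal (1 - η) := by
  have hκ : 0 < 1 - η := by linarith [hη.2]
  have hl0 : 0 < lam := by linarith [hlam.1]
  have hα0 : 0 < α := hl0.trans hlam.2
  have hM0 : (0 : ℝ) < M := by exact_mod_cast (by omega : 0 < M)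
  have hNp := (mem_upperPrimes.1 hN).1
  have hN0 : (0 : ℝ) < N := by exact_mod_cast hNp.pos
  -- The Markov bound is `3 A / (N t)`; with `M ≤ 2 N` this value of `t` makes it at most `1 - η`.
  set t := 6 * A / (1 - η) / M with ht
  have ht0 : 0 < t := by positivity
  have hb0 : ENNReal.ofReal (t ^ lam) ≠ 0 := by
    simpa using Real.rpow_pos_of_pos ht0 lam
  refine (uniformOn_lt_worstCaseError_le hα0.le hγ1 (p := 1 / lam) (by positivity) ?_ ?_ hNp hb0
    ENNReal.ofReal_ne_top).trans ?_
  · rw [div_le_iff₀ hl0]; linarith [hlam.1]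
  · rw [mul_one_div, le_div_iff₀ hl0]; linarith [hlam.2]
  · rw [ENNReal.ofReal_rpow_of_pos (by positivity), ← Real.rpow_mul ht0.le,
      mul_one_div_cancel hl0.ne', Real.rpow_one]
    refine ENNReal.div_le_of_le_mul ?_
    have h3 : (3 : ℝ≥0∞) * (N : ℝ≥0∞)⁻¹ = ENNReal.ofReal (3 * (N : ℝ)⁻¹) := by
      rw [ENNReal.ofReal_mul (by norm_num), ENNReal.ofReal_inv_of_pos hN0]
      simp
    rw [h3, ← ENNReal.ofReal_mul hκ.le]
    calc _ ≤ ENNReal.ofReal (3 * (N : ℝ)⁻¹) * ENNReal.ofReal A := by gcongr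
      _ = ENNReal.ofReal (3 * (N : ℝ)⁻¹ * A) := (ENNReal.ofReal_mul (by positivity)).symm
      _ ≤ _ := by
        refine ENNReal.ofReal_le_ofReal ?_
        have h2 : (M : ℝ) ≤ 2 * N := by exact_mod_cast (two_mul_gt_of_mem_upperPrimes hN).le
        have h4 : (1 - η) * t = 6 * A / M := by
          rw [ht]; field_simp
        rw [h4, ← div_eq_mul_inv, div_mul_eq_mul_div, div_le_div_iff₀ hN0 hM0]
        nlinarith

/-- The bound for frequencies of small weight. -/
theorem dualProb_le_of_lt_inv (hα : 0 ≤ α) (hγ1 : ∀ j, γ j ≤ 1)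
    (hη : η ∈ Set.Ioo (0 : ℝ) 1) {M : ℕ} (hM : 2 ≤ M)
    {sel : ℕ → (Fin (numTrials α η M) → Fin d → ℕ) → Fin (numTrials α η M)}
    (hsel : IsArgminSelection α γ d (numTrials α η M) M sel) {b : ℝ≥0∞}
    (hb : ∀ N ∈ upperPrimes M, uniformOn (genVectors d N)
      {z | b < worstCaseError α γ (qmcRule (rankOneLattice N z))} ≤ ENNReal.ofReal (1 - η))
    {k : Fin d → ℤ} (hk : k ≠ 0) (hbk : b < (korobovR α γ k)⁻¹) :
    dualProb d (numTrials α η M) M sel k ≤ ENNReal.ofReal ((M : ℝ) ^ (-(2 * α + 1))) := by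
  refine dualProb_le_of_forall_le hM fun N hN => ?_
  refine (trialLaw_selected_inDualLattice_le_pow hα hγ1 (mem_upperPrimes.1 hN) hsel hk
    hbk).trans ?_
  calc _ ≤ ENNReal.ofReal (1 - η) ^ numTrials α η M := by
        gcongr
        exact hb N hN
    _ = ENNReal.ofReal ((1 - η) ^ numTrials α η M) :=
        (ENNReal.ofReal_pow (by linarith [hη.2]) _).symm
    _ ≤ _ := ENNReal.ofReal_le_ofReal (pow_numTrials_le hη hM)

/-- The elementary estimate behind the bound for frequencies of large weight. -/
theorem rpow_add_le_of_inv_le {lam δ m a ρ x y L : ℝ} (hlam : 0 ≤ lam) (hδ0 : 0 ≤ δ) (hδ2 : δ ≤ 2)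
    (hm : 1 ≤ m) (ha : 1 ≤ a) (hρ : 0 < ρ) (hρb : ρ⁻¹ ≤ (a / m) ^ lam) (hx : 0 ≤ x) (hy : 0 ≤ y)
    (hL : Real.log 2 ≤ L) :
    (x * ρ ^ δ + y * L) / m ≤ (a ^ (2 * lam) * (x / Real.log 2 ^ 2 + y / Real.log 2)) *
      (m ^ (-lam - 1 / 2 + lam * δ / 2) * L) ^ 2 * ρ ^ 2 := by
  have hl2 : 0 < Real.log 2 := Real.log_pos one_lt_two
  have hL0 : 0 < L := hl2.trans_le hL
  have hm0 : 0 < m := one_pos.trans_le hm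
  have ha0 : 0 < a := one_pos.trans_le ha
  have hE : (m ^ (-lam - 1 / 2 + lam * δ / 2)) ^ 2 = m ^ (-(2 * lam) + lam * δ) / m := by
    rw [← Real.rpow_natCast, ← Real.rpow_mul hm0.le, ← Real.rpow_sub_one hm0.ne']
    congr 1; push_cast; ring
  have hinv : 0 < ρ⁻¹ := inv_pos.2 hρ
  -- Writing `ρ ^ s = (1/ρ) ^ (2 - s) * ρ ^ 2` brings in the threshold. The case `s = δ` serves the
  -- term from `log |k_j|`, the case `s = 0` the term from the number of trials.
  have key : ∀ s, 0 ≤ s → s ≤ δ → ρ ^ s ≤ a ^ (2 * lam) * m ^ (-(2 * lam) + lam * δ) * ρ ^ 2 := by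
    intro s hs0 hs
    have h1 : ρ ^ s = (ρ⁻¹) ^ (2 - s) * ρ ^ 2 := by
      rw [Real.inv_rpow hρ.le, ← Real.rpow_neg hρ.le, ← Real.rpow_natCast, ← Real.rpow_add hρ]
      congr 1; push_cast; ring
    rw [h1]
    gcongr
    calc (ρ⁻¹) ^ (2 - s) ≤ ((a / m) ^ lam) ^ (2 - s) :=
          Real.rpow_le_rpow hinv.le hρb (by linarith)
      _ = a ^ (lam * (2 - s)) * m ^ (-(lam * (2 - s))) := by
          rw [← Real.rpow_mul (by positivity), Real.div_rpow ha0.le hm0.le, Real.rpow_neg hm0.le,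
            div_eq_mul_inv]
      _ ≤ _ := by
          refine mul_le_mul (Real.rpow_le_rpow_of_exponent_le ha (by nlinarith))
            (Real.rpow_le_rpow_of_exponent_le hm (by nlinarith)) (by positivity) (by positivity)
  have hk1 := key δ hδ0 le_rfl
  have hk0 := key 0 le_rfl hδ0
  rw [Real.rpow_zero] at hk0
  set G := a ^ (2 * lam) * m ^ (-(2 * lam) + lam * δ) * ρ ^ 2 with hG
  have hG0 : 0 ≤ G := by positivity
  have hR : (a ^ (2 * lam) * (x / Real.log 2 ^ 2 + y / Real.log 2)) *
      (m ^ (-lam - 1 / 2 + lam * δ / 2) * L) ^ 2 * ρ ^ 2 =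
      (x * (G * (L / Real.log 2) ^ 2) + y * L * (G * (L / Real.log 2))) / m := by
    rw [mul_pow, hE, hG]
    field_simp
  rw [hR]
  -- The target carries `L ^ 2`; missing powers of `L` are supplied by factors `L / log 2 ≥ 1`.
  have hq : 1 ≤ L / Real.log 2 := (one_le_div hl2).2 hL
  have h1 : x * ρ ^ δ ≤ x * (G * (L / Real.log 2) ^ 2) :=
    mul_le_mul_of_nonneg_left (hk1.trans (le_mul_of_one_le_right hG0 (one_le_pow₀ hq))) hx
  have h2 : y * L ≤ y * L * (G * (L / Real.log 2)) :=
    le_mul_of_one_le_right (by positivity) (hk0.trans (le_mul_of_one_le_right hG0 hq))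
  gcongr

/-- From `log x ≤ x ^ (α δ) / (α δ)` and `|k_j| ^ α ≤ r(k)`. -/
theorem log_abs_le_korobovR_rpow (hα : 0 < α) (hγ1 : ∀ j, γ j ≤ 1) {k : Fin d → ℤ}
    (hR : korobovR α γ k ≠ ∞) {j : Fin d} (hj : k j ≠ 0) {δ : ℝ} (hδ : 0 < δ) :
    Real.log |(k j : ℝ)| ≤ (korobovR α γ k).toReal ^ δ / (α * δ) := by
  have h1 : |(k j : ℝ)| ^ α ≤ (korobovR α γ k).toReal :=
    (ENNReal.ofReal_le_iff_le_toReal hR).1 (ofReal_rpow_le_korobovR hα.le hγ1 k j hj)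
  refine (Real.log_le_rpow_div (abs_nonneg _) (mul_pos hα hδ)).trans ?_
  rw [Real.rpow_mul (abs_nonneg _)]
  gcongr

/-- The error bound, uniformly over all dimensions in which the sum of the inverse weights to the
power `1 / lam` is bounded by `A`. -/
theorem exists_shiftedLatticeRMSE_le (hγ1 : ∀ j, γ j ≤ 1) (hη : η ∈ Set.Ioo (0 : ℝ) 1)
    {lam : ℝ} (hlam : lam ∈ Set.Ico (1 / 2) α) {δ : ℝ} (hδ : δ ∈ Set.Ioc 0 (1 / α)) {A : ℝ}
    (hA : 1 ≤ A) : ∃ C : ℝ, 0 < C ∧ ∀ d : ℕ,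
      ∑' k : Fin d → ℤ, (korobovR α γ k)⁻¹ ^ (1 / lam) ≤ ENNReal.ofReal A →
      ∀ M : ℕ, 2 ≤ M → ∀ sel, IsArgminSelection α γ d (numTrials α η M) M sel →
        shiftedLatticeRMSE α γ d (numTrials α η M) M sel ≤
          ENNReal.ofReal (C * ((M : ℝ) ^ (-lam - 1 / 2 + lam * δ / 2) * Real.log M)) := by
  obtain ⟨c, hc, hprimes⟩ := exists_card_filter_dvd_div_card_le
  have hκ : 0 < 1 - η := by linarith [hη.2]
  have hlogκ : Real.log (1 - η) < 0 := Real.log_neg hκ (by linarith [hη.1])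
  have hl0 : 0 < lam := by linarith [hlam.1]
  have hα0 : 0 < α := hl0.trans hlam.2
  have hα2 : 1 / 2 < α := hlam.1.trans_lt hlam.2
  have hδ0 : 0 < δ := hδ.1
  have hδ2 : δ ≤ 2 := hδ.2.trans (by rw [div_le_iff₀ hα0]; linarith)
  have hl2 : 0 < Real.log 2 := Real.log_pos one_lt_two
  set D := (2 * α + 1) / (-Real.log (1 - η)) + 1 / Real.log 2 with hD
  have hD0 : 0 ≤ D := add_nonneg (div_nonneg (by linarith) (by linarith)) (by positivity)
  set a := 6 * A / (1 - η) with ha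
  have ha1 : 1 ≤ a := by
    rw [ha, one_le_div hκ]; linarith [hη.1]
  set X := a ^ (2 * lam) * (c / (α * δ) / Real.log 2 ^ 2 + 4 * D / Real.log 2) with hX
  have hX0 : 0 ≤ X := by positivity
  -- The first range of frequencies needs `1 ≤ C * log 2`, the second needs `X ≤ C ^ 2`.
  refine ⟨1 + 1 / Real.log 2 + X, by positivity, fun d hS M hM sel hsel => ?_⟩
  set C := 1 + 1 / Real.log 2 + X with hC
  have hC0 : 0 < C := by positivity
  have hCX : X ≤ C ^ 2 := by
    have : 0 < 1 / Real.log 2 := by positivity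
    nlinarith
  have hCl : 1 ≤ C * Real.log 2 := by
    have : 1 = 1 / Real.log 2 * Real.log 2 := by field_simp
    rw [this]
    gcongr
    linarith
  have hM1 : (1 : ℝ) ≤ M := by exact_mod_cast (by omega : 1 ≤ M)
  have hM0 : (0 : ℝ) < M := by linarith
  have hlM : Real.log 2 ≤ Real.log M := Real.log_le_log two_pos (by exact_mod_cast hM)
  have hlM0 : 0 < Real.log M := hl2.trans_le hlM
  set E := (M : ℝ) ^ (-lam - 1 / 2 + lam * δ / 2) with hE
  have hE0 : 0 < E := by positivity
  have hCEL : 0 < C * (E * Real.log M) := by positivity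
  refine shiftedLatticeRMSE_le sel fun k hk => ?_
  set b := ENNReal.ofReal ((a / M) ^ lam) with hb
  -- For small weight all trials must have failed; for large weight the random prime and the union
  -- bound decide.
  rcases lt_or_ge b (korobovR α γ k)⁻¹ with hbk | hbk
  · refine (dualProb_le_of_lt_inv hα0.le hγ1 hη hM hsel (fun N hN =>
      uniformOn_threshold_lt_worstCaseError_le hγ1 hη hlam hA hS hM hN) hk hbk).trans ?_
    refine le_trans ?_ (le_mul_of_one_le_right' (one_le_pow₀ (one_le_korobovR hα0.le hγ1 k)))
    rw [← ENNReal.ofReal_pow hCEL.le]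
    refine ENNReal.ofReal_le_ofReal ?_
    have h1 : (M : ℝ) ^ (-(2 * α + 1)) = ((M : ℝ) ^ (-α - 1 / 2)) ^ 2 := by
      rw [← Real.rpow_natCast, ← Real.rpow_mul hM0.le]
      congr 1; push_cast; ring
    rw [h1]
    gcongr
    calc (M : ℝ) ^ (-α - 1 / 2) ≤ E := by
          refine Real.rpow_le_rpow_of_exponent_le hM1 ?_
          have : 0 < lam * δ := by positivity
          linarith [hlam.2]
      _ ≤ (C * Real.log 2) * E := le_mul_of_one_le_left hE0.le hCl
      _ ≤ (C * Real.log M) * E := by gcongr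
      _ = _ := by ring
  · by_cases htop : korobovR α γ k = ∞
    · rw [htop, ENNReal.top_pow two_ne_zero, ENNReal.mul_top]
      · exact le_top
      · exact pow_ne_zero _ (by simpa using hCEL)
    obtain ⟨j, hj⟩ := Function.ne_iff.1 hk
    have hj' : k j ≠ 0 := hj
    set ρ := (korobovR α γ k).toReal with hρ
    have hRne : korobovR α γ k ≠ 0 := (one_pos.trans_le (one_le_korobovR hα0.le hγ1 k)).ne'
    have hρ0 : 0 < ρ := ENNReal.toReal_pos hRne htop
    have hRρ : korobovR α γ k = ENNReal.ofReal ρ := (ENNReal.ofReal_toReal htop).symm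
    have hρb : ρ⁻¹ ≤ (a / M) ^ lam := by
      rw [hRρ, ← ENNReal.ofReal_inv_of_pos hρ0, hb] at hbk
      exact (ENNReal.ofReal_le_ofReal_iff (by positivity)).1 hbk
    refine (dualProb_le hM sel k j).trans ?_
    rw [hRρ, ← ENNReal.ofReal_pow hCEL.le, ← ENNReal.ofReal_pow hρ0.le,
      ← ENNReal.ofReal_mul (by positivity)]
    refine ENNReal.ofReal_le_ofReal ?_
    have hlogk := log_abs_le_korobovR_rpow hα0 hγ1 htop hj' hδ0
    have hr := numTrials_le hα0.le hη hM
    calc _ ≤ c * Real.log |(k j : ℝ)| / M + 4 * (D * Real.log M) / M := by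
          refine add_le_add (hprimes M hM (k j) hj') ?_
          gcongr
      _ ≤ c * (ρ ^ δ / (α * δ)) / M + 4 * (D * Real.log M) / M := by gcongr
      _ = (c / (α * δ) * ρ ^ δ + 4 * D * Real.log M) / M := by ring
      _ ≤ X * (E * Real.log M) ^ 2 * ρ ^ 2 :=
          rpow_add_le_of_inv_le hl0.le hδ0.le hδ2 hM1 ha1 hρ0 hρb (by positivity) (by positivity)
            hlM
      _ ≤ C ^ 2 * (E * Real.log M) ^ 2 * ρ ^ 2 := by gcongr
      _ = _ := by rw [mul_pow C]

/-- The logarithm and the parameters `lam`, `δ` can be absorbed in the exponent. -/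
theorem exists_rpow_mul_log_le (hα : 1 / 2 < α) {ε : ℝ} (hε : 0 < ε) :
    ∃ lam ∈ Set.Ico (1 / 2) α, ∃ δ ∈ Set.Ioc 0 (1 / α), ∀ M : ℕ, 2 ≤ M →
      (M : ℝ) ^ (-lam - 1 / 2 + lam * δ / 2) * Real.log M ≤
        2 / ε * (M : ℝ) ^ (-α - 1 / 2 + ε) := by
  have hα0 : 0 < α := by linarith
  -- The exponent loses at most `ε/4` through `lam`, `ε/8` through `δ` and `ε/2` through the
  -- logarithm.
  refine ⟨max (1 / 2) (α - ε / 4), ⟨le_max_left _ _, max_lt hα (by linarith)⟩,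
    min (1 / α) (ε / (4 * α)), ⟨by positivity, min_le_left _ _⟩, fun M hM => ?_⟩
  set lam := max (1 / 2) (α - ε / 4) with hlam
  set δ := min (1 / α) (ε / (4 * α)) with hδ
  have hM1 : (1 : ℝ) ≤ M := by exact_mod_cast (by omega : 1 ≤ M)
  have hM0 : (0 : ℝ) < M := by linarith
  have h1 : α - ε / 4 ≤ lam := le_max_right _ _
  have h2 : lam ≤ α := max_le hα.le (by linarith)
  have hδ0 : 0 < δ := by positivity
  have h3 : lam * δ ≤ ε / 4 := by
    calc lam * δ ≤ α * (ε / (4 * α)) := by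
          gcongr
          exact min_le_right _ _
      _ = ε / 4 := by field_simp
  calc (M : ℝ) ^ (-lam - 1 / 2 + lam * δ / 2) * Real.log M
      ≤ (M : ℝ) ^ (-lam - 1 / 2 + lam * δ / 2) * ((M : ℝ) ^ (ε / 2) / (ε / 2)) := by
        gcongr
        exact Real.log_le_rpow_div hM0.le (by positivity)
    _ = 2 / ε * (M : ℝ) ^ (-lam - 1 / 2 + lam * δ / 2 + ε / 2) := by
        rw [Real.rpow_add hM0 _ (ε / 2)]
        field_simp
    _ ≤ _ := by
        refine mul_le_mul_of_nonneg_left (Real.rpow_le_rpow_of_exponent_le hM1 ?_) (by positivity)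
        linarith

/-- For weights in `[0, 1]` the larger exponent `1 / lam` gives smaller terms, so summability at `1
/ α` covers every `lam ≤ α`. -/
theorem sum_rpow_le_tsum (hα : 0 < α) (hγ0 : ∀ j, 0 ≤ γ j) (hγ1 : ∀ j, γ j ≤ 1) {lam : ℝ}
    (hl0 : 0 < lam) (hlam : lam ≤ α) (hs : Summable fun j => γ j ^ (1 / α)) (d : ℕ) :
    ∑ j : Fin d, γ j ^ (1 / lam) ≤ ∑' j, γ j ^ (1 / α) := by
  calc ∑ j : Fin d, γ j ^ (1 / lam) ≤ ∑ j : Fin d, γ j ^ (1 / α) := by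
        refine Finset.sum_le_sum fun j _ => ?_
        exact Real.rpow_le_rpow_of_exponent_ge' (hγ0 j) (hγ1 j) (by positivity)
          (one_div_le_one_div_of_le hl0 hlam)
    _ = ∑ j ∈ Finset.range d, γ j ^ (1 / α) :=
        Fin.sum_univ_eq_sum_range (fun j => γ j ^ (1 / α)) d
    _ ≤ _ := hs.sum_le_tsum _ fun j _ => Real.rpow_nonneg (hγ0 j) _

end Rate

theorem corollary3p6 (α : ℝ) (hα : 1 / 2 < α) (γ : ℕ → ℝ) (hγ0 : ∀ j, 0 ≤ γ j)
    (hγ1 : ∀ j, γ j ≤ 1) (η : ℝ) (hη : η ∈ Set.Ioo (0 : ℝ) 1) :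
    -- the rate, for every dimension
    (∀ d : ℕ, ∀ lam ∈ Set.Ico (1 / 2) α, ∀ δ ∈ Set.Ioc 0 (1 / α), ∃ C : ℝ, 0 < C ∧
      ∀ M : ℕ, 2 ≤ M → EnoughPoints α γ d η M →
        ∀ sel, IsArgminSelection α γ d (numTrials α η M) M sel →
          shiftedLatticeRMSE α γ d (numTrials α η M) M sel ≤
            ENNReal.ofReal (C * ((M : ℝ) ^ (-lam - 1 / 2 + lam * δ / 2) * Real.log M))) ∧
    -- it comes arbitrarily close to the exponent `-α - 1/2`
    (∀ d : ℕ, ∀ ε : ℝ, 0 < ε → ∃ C : ℝ, 0 < C ∧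
      ∀ M : ℕ, 2 ≤ M → EnoughPoints α γ d η M →
        ∀ sel, IsArgminSelection α γ d (numTrials α η M) M sel →
          shiftedLatticeRMSE α γ d (numTrials α η M) M sel ≤
            ENNReal.ofReal (C * (M : ℝ) ^ (-α - 1 / 2 + ε))) ∧
    -- for summable weights the constants do not depend on the dimension
    (Summable (fun j => γ j ^ (1 / α)) →
      (∀ lam ∈ Set.Ico (1 / 2) α, ∀ δ ∈ Set.Ioc 0 (1 / α), ∃ C : ℝ, 0 < C ∧
        ∀ d M : ℕ, 2 ≤ M → EnoughPoints α γ d η M →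
          ∀ sel, IsArgminSelection α γ d (numTrials α η M) M sel →
            shiftedLatticeRMSE α γ d (numTrials α η M) M sel ≤
              ENNReal.ofReal (C * ((M : ℝ) ^ (-lam - 1 / 2 + lam * δ / 2) * Real.log M))) ∧
      (∀ ε : ℝ, 0 < ε → ∃ C : ℝ, 0 < C ∧
        ∀ d M : ℕ, 2 ≤ M → EnoughPoints α γ d η M →
          ∀ sel, IsArgminSelection α γ d (numTrials α η M) M sel →
            shiftedLatticeRMSE α γ d (numTrials α η M) M sel ≤
              ENNReal.ofReal (C * (M : ℝ) ^ (-α - 1 / 2 + ε)))) := by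
  have hα0 : 0 < α := by linarith
  have hrate : ∀ d : ℕ, ∀ lam ∈ Set.Ico (1 / 2) α, ∀ δ ∈ Set.Ioc 0 (1 / α), ∃ C : ℝ, 0 < C ∧
      ∀ M : ℕ, 2 ≤ M → EnoughPoints α γ d η M →
        ∀ sel, IsArgminSelection α γ d (numTrials α η M) M sel →
          shiftedLatticeRMSE α γ d (numTrials α η M) M sel ≤
            ENNReal.ofReal (C * ((M : ℝ) ^ (-lam - 1 / 2 + lam * δ / 2) * Real.log M)) := by
    intro d lam hlam δ hδ
    have hl0 : 0 < lam := by linarith [hlam.1]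
    obtain ⟨c, hc, hsum⟩ := exists_tsum_korobovR_inv_rpow_le (α := α) hγ0 (p := 1 / lam)
      (by positivity) (by rw [mul_one_div, one_lt_div hl0]; exact hlam.2)
    have hA : 1 ≤ Real.exp (c * ∑ j : Fin d, γ j ^ (1 / lam)) :=
      Real.one_le_exp (mul_nonneg hc (Finset.sum_nonneg fun j _ => Real.rpow_nonneg (hγ0 j) _))
    obtain ⟨C, hC, h⟩ := exists_shiftedLatticeRMSE_le hγ1 hη hlam hδ hA
    exact ⟨C, hC, fun M hM _ => h d (hsum d) M hM⟩
  have hrate' : Summable (fun j => γ j ^ (1 / α)) →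
      ∀ lam ∈ Set.Ico (1 / 2) α, ∀ δ ∈ Set.Ioc 0 (1 / α), ∃ C : ℝ, 0 < C ∧
        ∀ d M : ℕ, 2 ≤ M → EnoughPoints α γ d η M →
          ∀ sel, IsArgminSelection α γ d (numTrials α η M) M sel →
            shiftedLatticeRMSE α γ d (numTrials α η M) M sel ≤
              ENNReal.ofReal (C * ((M : ℝ) ^ (-lam - 1 / 2 + lam * δ / 2) * Real.log M)) := by
    intro hs lam hlam δ hδ
    have hl0 : 0 < lam := by linarith [hlam.1]
    obtain ⟨c, hc, hsum⟩ := exists_tsum_korobovR_inv_rpow_le (α := α) hγ0 (p := 1 / lam)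
      (by positivity) (by rw [mul_one_div, one_lt_div hl0]; exact hlam.2)
    -- The full series replaces the sum over `d` coordinates, so the constant is fixed before `d`.
    have hA : 1 ≤ Real.exp (c * ∑' j, γ j ^ (1 / α)) :=
      Real.one_le_exp (mul_nonneg hc (tsum_nonneg fun j => Real.rpow_nonneg (hγ0 j) _))
    obtain ⟨C, hC, h⟩ := exists_shiftedLatticeRMSE_le hγ1 hη hlam hδ hA
    refine ⟨C, hC, fun d M hM _ => h d ((hsum d).trans (ENNReal.ofReal_le_ofReal ?_)) M hM⟩
    gcongr
    exact sum_rpow_le_tsum hα0 hγ0 hγ1 hl0 hlam.2.le hs d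
  refine ⟨hrate, fun d ε hε => ?_, fun hs => ⟨hrate' hs, fun ε hε => ?_⟩⟩
  · obtain ⟨lam, hlam, δ, hδ, hle⟩ := exists_rpow_mul_log_le hα hε
    obtain ⟨C, hC, h⟩ := hrate d lam hlam δ hδ
    refine ⟨C * (2 / ε), by positivity, fun M hM hE sel hsel => (h M hM hE sel hsel).trans
      (ENNReal.ofReal_le_ofReal ?_)⟩
    rw [mul_assoc C]
    exact mul_le_mul_of_nonneg_left (hle M hM) hC.le
  · obtain ⟨lam, hlam, δ, hδ, hle⟩ := exists_rpow_mul_log_le hα hε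
    obtain ⟨C, hC, h⟩ := hrate' hs lam hlam δ hδ
    refine ⟨C * (2 / ε), by positivity, fun d M hM hE sel hsel => (h d M hM hE sel hsel).trans
      (ENNReal.ofReal_le_ofReal ?_)⟩
    rw [mul_assoc C]
    exact mul_le_mul_of_nonneg_left (hle M hM) hC.le
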